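/- Let $G$ be a connected simple graph, possibly infinite, all of whose vertex degrees are at most some fixed $D<\infty$. For a vertex $u$ of $G$, let $\mathcal{P}(u)$ be the set of finite paths (without repeated vertices) in $G$ that start at $u$, including the one-vertex path $u$, and let the path tree $T(G,u)$ be the graph with vertex set $\mathcal{P}(u)$ in which two paths are adjacent if one of them is obtained from the other by adding one edge at its end. Let $A$ be the adjacency operator of $T(G,u)$, a bounded self-adjoint operator on $\ell^2(\mathcal{P}(u))$ of norm at most $D$, and let $\chi_u$ be the characteristic vector of the one-vertex path $u$. The matching measure $\nu_{G,u}$ is the spectral measure of $A$ at $\chi_u$, that is, the unique probability measure on $[-D,D]$ such that $\langle A^n\chi_u,\chi_u\rangle=\int x^n\,d\nu_{G,u}(x)$ for all $n\ge 1$. Let $\theta\in\mathbb{R}$ and assume that $G$ is $\theta$-critical, that is, every vertex $u$ of $G$ is $\theta$-essential: $\nu_{G,u}(\{\theta\})>0$. Then \[\sum_{u\in V(G)}\nu_{G,u}(\{\theta\})=1.\] -/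

import Mathlib

open MeasureTheory
open scoped CompactlySupported

noncomputable section

namespace MatchingMeasure

universe u

/-! ### Graphs of bounded degree -/

/-- Every vertex of `G` has at most `D` neighbours. -/
def BoundedDegree {V : Type u} (G : SimpleGraph V) (D : ℕ) : Prop :=
  ∀ v, (G.neighborSet v).encard ≤ D

theorem BoundedDegree.finite {V : Type u} {G : SimpleGraph V} {D : ℕ}
    (hG : BoundedDegree G D) (v : V) : (G.neighborSet v).Finite :=
  Set.finite_of_encard_le_coe (hG v)

/-- The finite set of neighbours of a vertex. -/
def BoundedDegree.nbrs {V : Type u} {G : SimpleGraph V} {D : ℕ}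
    (hG : BoundedDegree G D) (v : V) : Finset V :=
  (hG.finite v).toFinset

theorem BoundedDegree.mem_nbrs {V : Type u} {G : SimpleGraph V} {D : ℕ}
    (hG : BoundedDegree G D) {v w : V} : w ∈ hG.nbrs v ↔ G.Adj v w := by
  simp [BoundedDegree.nbrs]

theorem BoundedDegree.card_nbrs_le {V : Type u} {G : SimpleGraph V} {D : ℕ}
    (hG : BoundedDegree G D) (v : V) : (hG.nbrs v).card ≤ D := by
  have h := hG v
  rw [(hG.finite v).encard_eq_coe_toFinset_card] at h
  exact_mod_cast h

/-! ### The adjacency operator of a graph of bounded degree -/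

theorem sum_norm_sq_nbrs_le {V : Type u} {G : SimpleGraph V} {D : ℕ}
    (hG : BoundedDegree G D) (f : lp (fun _ : V => ℂ) 2) (s : Finset V) :
    ∑ v ∈ s, ‖∑ w ∈ hG.nbrs v, f w‖ ^ (2 : ENNReal).toReal ≤
      ((D : ℝ) * ‖f‖) ^ (2 : ENNReal).toReal := by
  classical
  have h2 : (2 : ENNReal).toReal = ((2 : ℕ) : ℝ) := by simp
  have hf : ∀ t : Finset V, ∑ w ∈ t, ‖f w‖ ^ 2 ≤ ‖f‖ ^ 2 := by
    intro t
    have := lp.sum_rpow_le_norm_rpow (p := 2) (by simp) f t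
    simpa only [h2, Real.rpow_natCast] using this
  simp only [h2, Real.rpow_natCast]
  have step1 : ∀ v ∈ s, ‖∑ w ∈ hG.nbrs v, f w‖ ^ 2 ≤ (D : ℝ) * ∑ w ∈ hG.nbrs v, ‖f w‖ ^ 2 := by
    intro v _
    calc ‖∑ w ∈ hG.nbrs v, f w‖ ^ 2 ≤ (∑ w ∈ hG.nbrs v, ‖f w‖) ^ 2 := by
          gcongr
          exact norm_sum_le _ _
      _ ≤ ((hG.nbrs v).card : ℝ) * ∑ w ∈ hG.nbrs v, ‖f w‖ ^ 2 := sq_sum_le_card_mul_sum_sq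
      _ ≤ (D : ℝ) * ∑ w ∈ hG.nbrs v, ‖f w‖ ^ 2 := by
          gcongr
          exact hG.card_nbrs_le v
  have step2 : ∑ v ∈ s, ∑ w ∈ hG.nbrs v, ‖f w‖ ^ 2 =
      ∑ w ∈ s.biUnion hG.nbrs, ∑ v ∈ s.filter (fun v => G.Adj v w), ‖f w‖ ^ 2 := by
    refine Finset.sum_comm' ?_
    intro v w
    simp only [Finset.mem_filter, Finset.mem_biUnion, hG.mem_nbrs]
    constructor
    · rintro ⟨hv, hw⟩
      exact ⟨⟨hv, hw⟩, v, hv, hw⟩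
    · rintro ⟨h, _⟩
      exact h
  have step3 : ∀ w ∈ s.biUnion hG.nbrs,
      ∑ v ∈ s.filter (fun v => G.Adj v w), ‖f w‖ ^ 2 ≤ (D : ℝ) * ‖f w‖ ^ 2 := by
    intro w _
    rw [Finset.sum_const, nsmul_eq_mul]
    have hsub : s.filter (fun v => G.Adj v w) ⊆ hG.nbrs w := by
      intro v hv
      rw [hG.mem_nbrs]
      exact (Finset.mem_filter.mp hv).2.symm
    have := (Finset.card_le_card hsub).trans (hG.card_nbrs_le w)
    gcongr
  calc ∑ v ∈ s, ‖∑ w ∈ hG.nbrs v, f w‖ ^ 2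
      ≤ ∑ v ∈ s, (D : ℝ) * ∑ w ∈ hG.nbrs v, ‖f w‖ ^ 2 := Finset.sum_le_sum step1
    _ = (D : ℝ) * ∑ w ∈ s.biUnion hG.nbrs, ∑ v ∈ s.filter (fun v => G.Adj v w), ‖f w‖ ^ 2 := by
        rw [← Finset.mul_sum, step2]
    _ ≤ (D : ℝ) * ∑ w ∈ s.biUnion hG.nbrs, (D : ℝ) * ‖f w‖ ^ 2 := by
        gcongr with w hw
        exact step3 w hw
    _ = (D : ℝ) * ((D : ℝ) * ∑ w ∈ s.biUnion hG.nbrs, ‖f w‖ ^ 2) := by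
        rw [← Finset.mul_sum (s.biUnion hG.nbrs) (fun w => ‖f w‖ ^ 2) (D : ℝ)]
    _ ≤ (D : ℝ) * ((D : ℝ) * ‖f‖ ^ 2) := by
        gcongr
        exact hf _
    _ = ((D : ℝ) * ‖f‖) ^ 2 := by ring

/-- The adjacency operator of a graph with degrees at most `D`, as a bounded operator on the complex
Hilbert space `ℓ²(V)`: the value of `A f` at `v` is the sum of `f` over the neighbours of `v`. -/
def adjOperator {V : Type u} {G : SimpleGraph V} {D : ℕ} (hG : BoundedDegree G D) :
    lp (fun _ : V => ℂ) 2 →L[ℂ] lp (fun _ : V => ℂ) 2 :=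
  LinearMap.mkContinuous
    { toFun := fun f =>
        ⟨fun v => ∑ w ∈ hG.nbrs v, f w, memℓp_gen' (sum_norm_sq_nbrs_le hG f)⟩
      map_add' := by
        intro f g
        ext v
        exact Finset.sum_add_distrib
      map_smul' := by
        intro c f
        ext v
        simp [Finset.mul_sum] }
    (D : ℝ)
    (fun f => lp.norm_le_of_forall_sum_le (by simp) (by positivity) (sum_norm_sq_nbrs_le hG f))

theorem adjOperator_apply {V : Type u} {G : SimpleGraph V} {D : ℕ} (hG : BoundedDegree G D)
    (f : lp (fun _ : V => ℂ) 2) (v : V) :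
    (adjOperator hG f : V → ℂ) v = ∑ w ∈ hG.nbrs v, f w := rfl

theorem norm_adjOperator_le {V : Type u} {G : SimpleGraph V} {D : ℕ} (hG : BoundedDegree G D) :
    ‖adjOperator hG‖ ≤ (D : ℝ) :=
  LinearMap.mkContinuous_norm_le _ (by positivity) _

open Classical in
/-- The characteristic vector of a vertex. -/
def chi {V : Type u} (v : V) : lp (fun _ : V => ℂ) 2 := lp.single 2 v (1 : ℂ)

theorem inner_chi_left {V : Type u} (v : V) (f : lp (fun _ : V => ℂ) 2) :
    inner ℂ (chi v) f = f v := by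
  classical
  simp [chi, lp.inner_single_left]

theorem norm_chi {V : Type u} (v : V) : ‖chi v‖ = 1 := by
  classical
  simp [chi, lp.norm_single]

theorem adjOperator_isSelfAdjoint {V : Type u} {G : SimpleGraph V} {D : ℕ}
    (hG : BoundedDegree G D) : IsSelfAdjoint (adjOperator hG) := by
  classical
  have key : ∀ v w : V, (adjOperator hG (chi w) : V → ℂ) v = if G.Adj v w then 1 else 0 := by
    intro v w
    rw [adjOperator_apply]
    simp [chi, Pi.single_apply, hG.mem_nbrs]
  rw [ContinuousLinearMap.isSelfAdjoint_iff']
  have hsingle : ∀ w : V,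
      (adjOperator hG).adjoint (chi w) = adjOperator hG (chi w) := by
    intro w
    ext v
    rw [← inner_chi_left, ContinuousLinearMap.adjoint_inner_right, ← inner_conj_symm,
      inner_chi_left, key, key]
    by_cases h : G.Adj v w
    · simp [h, h.symm]
    · have h' : ¬ G.Adj w v := fun h' => h h'.symm
      simp [h, h']
  refine ContinuousLinearMap.ext fun f => ?_
  have hs := lp.hasSum_single (E := fun _ : V => ℂ) (p := 2) (by simp) f
  have hchi : ∀ w : V, lp.single (E := fun _ : V => ℂ) 2 w (f w) = f w • chi w := by
    intro w
    rw [chi, ← lp.single_smul]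
    simp
  refine (hs.mapL (adjOperator hG).adjoint).unique ?_
  convert hs.mapL (adjOperator hG) using 2 with w
  rw [hchi, map_smul, map_smul, hsingle]

/-! ### Spectral measures -/

/-- The positive functional `f ↦ ⟨f(A) x, x⟩` on `C_c(ℝ)`, where `f(A)` is given by the continuous
functional calculus of the self-adjoint operator `A`. -/
def spectralFunctional {H : Type u} [NormedAddCommGroup H] [InnerProductSpace ℂ H] [CompleteSpace H]
    (A : H →L[ℂ] H) (x : H) : C_c(ℝ, ℝ) →ₚ[ℝ] ℝ :=
  PositiveLinearMap.mk₀
    { toFun := fun f => (inner ℂ (cfc (fun t : ℝ => f t) A x) x).re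
      map_add' := by
        intro f g
        have h : cfc (fun t : ℝ => (f + g) t) A =
            cfc (fun t : ℝ => f t) A + cfc (fun t : ℝ => g t) A :=
          cfc_add (a := A) (fun t : ℝ => f t) (fun t : ℝ => g t)
            f.continuous.continuousOn g.continuous.continuousOn
        rw [h]
        simp
      map_smul' := by
        intro c f
        have h : cfc (fun t : ℝ => (c • f) t) A = c • cfc (fun t : ℝ => f t) A :=
          cfc_smul (a := A) c (fun t : ℝ => f t) f.continuous.continuousOn
        rw [h]
        simp [inner_smul_left_eq_smul] }
    (by
      intro f hf
      have h : 0 ≤ cfc (fun t : ℝ => f t) A := cfc_nonneg fun t _ => hf t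
      exact ((ContinuousLinearMap.nonneg_iff_isPositive _).mp h).re_inner_nonneg_left x)

/-- The spectral measure of the self-adjoint operator `A` at the vector `x`: the measure `ν` on `ℝ`
that represents `f ↦ ⟨f(A) x, x⟩` by the Riesz–Markov–Kakutani theorem, so that `ν E = ⟨π(E) x, x⟩`
for the projection-valued measure `π` of `A`. -/
def spectralMeasure {H : Type u} [NormedAddCommGroup H] [InnerProductSpace ℂ H] [CompleteSpace H]
    (A : H →L[ℂ] H) (x : H) : Measure ℝ :=
  RealRMK.rieszMeasure (spectralFunctional A x)

/-- For a self-adjoint `A` with `‖A‖ ≤ D` and a unit vector `χ`, the spectral measure is a probability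
measure concentrated on `[-D, D]` whose moments are `⟨Aⁿ χ, χ⟩`. -/
theorem spectralMeasure_spec {H : Type u} [NormedAddCommGroup H] [InnerProductSpace ℂ H]
    [CompleteSpace H] {A : H →L[ℂ] H} (hA : IsSelfAdjoint A) {D : ℝ} (hn : ‖A‖ ≤ D)
    {χ : H} (hχ1 : ‖χ‖ = 1) :
    IsProbabilityMeasure (spectralMeasure A χ) ∧
    spectralMeasure A χ (Set.Icc (-D) D)ᶜ = 0 ∧
    ∀ n : ℕ, ((∫ x, x ^ n ∂(spectralMeasure A χ) : ℝ) : ℂ) = inner ℂ ((A ^ n) χ) χ := by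
  have hspec : ∀ t ∈ spectrum ℝ A, |t| ≤ D := by
    intro t ht
    have h1 : ‖t‖ ≤ ‖A‖ * ‖(1 : H →L[ℂ] H)‖ :=
      spectrum.norm_le_norm_mul_of_mem ht
    have hD : 0 ≤ D := (norm_nonneg A).trans hn
    have h2 : ‖A‖ * ‖(1 : H →L[ℂ] H)‖ ≤ D * 1 := by
      gcongr
      exact ContinuousLinearMap.norm_id_le
    rw [Real.norm_eq_abs] at h1
    linarith
  have hint : ∀ f : C_c(ℝ, ℝ), ∫ x, f x ∂(spectralMeasure A χ) =
      (inner ℂ (cfc (fun t : ℝ => f t) A χ) χ).re :=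
    fun f => RealRMK.integral_rieszMeasure (spectralFunctional A χ) f
  have hcs : ∀ (r : ℝ) (f : ℝ → ℝ), Continuous f → (∀ x, r < |x| → f x = 0) →
      ∃ F : C_c(ℝ, ℝ), ∀ x, F x = f x := by
    intro r f hf h0
    refine ⟨⟨⟨f, hf⟩, ?_⟩, fun x => rfl⟩
    refine HasCompactSupport.intro (K := Set.Icc (-r) r) isCompact_Icc ?_
    intro x hx
    apply h0
    by_contra hcon
    exact hx (abs_le.mp (not_lt.mp hcon))
  have hfin : IsFiniteMeasureOnCompacts (spectralMeasure A χ) := by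
    unfold spectralMeasure
    infer_instance
  have hsupp : spectralMeasure A χ (Set.Icc (-D) D)ᶜ = 0 := by
    have hn : ∀ n : ℕ, spectralMeasure A χ {x : ℝ | D < |x| ∧ |x| < n} = 0 := by
      intro n
      obtain ⟨F, hF⟩ := hcs n (fun x => max 0 (|x| - D) * max 0 (n - |x|)) (by fun_prop) (by
        intro x hx
        have : max 0 ((n : ℝ) - |x|) = 0 := max_eq_left (by linarith)
        simp [this])
      have hzero : ∫ x, F x ∂(spectralMeasure A χ) = 0 := by
        rw [hint]
        have : cfc (fun t : ℝ => F t) A = cfc (fun _ : ℝ => (0 : ℝ)) A := by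
          refine cfc_congr fun t ht => ?_
          have h1 := hspec t ht
          have h2 : max 0 (|t| - D) = 0 := max_eq_left (by linarith)
          simp [hF, h2]
        rw [this]
        simp
      have hnn : 0 ≤ fun x => F x := by
        intro x
        simp only [hF, Pi.zero_apply]
        positivity
      have hae := (integral_eq_zero_iff_of_nonneg hnn F.integrable).mp hzero
      refine measure_mono_null ?_ (ae_iff.mp hae)
      rintro x ⟨h1, h2⟩
      simp only [Set.mem_ofPred_eq, hF, Pi.zero_apply]
      have h3 : 0 < max 0 (|x| - D) := lt_max_of_lt_right (by linarith)
      have h4 : 0 < max 0 ((n : ℝ) - |x|) := lt_max_of_lt_right (by linarith)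
      positivity
    refine measure_mono_null ?_ (measure_iUnion_null hn)
    intro x hx
    obtain ⟨n, hxn⟩ := exists_nat_gt |x|
    refine Set.mem_iUnion.mpr ⟨n, ?_, hxn⟩
    by_contra hcon
    exact hx (abs_le.mp (not_lt.mp hcon))
  have hmom : ∀ n : ℕ, ((∫ x, x ^ n ∂(spectralMeasure A χ) : ℝ) : ℂ) =
      inner ℂ ((A ^ n) χ) χ := by
    intro n
    obtain ⟨F, hF⟩ := hcs (D + 1)
      (fun x => x ^ n * max 0 (min 1 (D + 1 - |x|))) (by fun_prop) (by
        intro x hx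
        have : max 0 (min 1 (D + 1 - |x|)) = 0 :=
          max_eq_left ((min_le_right _ _).trans (by linarith))
        simp [this])
    have hFin : ∀ x : ℝ, |x| ≤ D → F x = x ^ n := by
      intro x hx
      have h1 : min 1 (D + 1 - |x|) = 1 := min_eq_left (by linarith)
      simp [hF, h1]
    have h1 : ∫ x, x ^ n ∂(spectralMeasure A χ) = ∫ x, F x ∂(spectralMeasure A χ) := by
      refine integral_congr_ae ?_
      have : ∀ᵐ x ∂(spectralMeasure A χ), x ∈ Set.Icc (-D) D := by
        rw [ae_iff]
        exact hsupp
      filter_upwards [this] with x hx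
      exact (hFin x (abs_le.mpr hx)).symm
    have h2 : cfc (fun t : ℝ => F t) A = A ^ n := by
      rw [← cfc_pow_id (R := ℝ) A n hA]
      exact cfc_congr fun t ht => hFin t (hspec t ht)
    rw [h1, hint, h2]
    have hsa : (A ^ n).IsSymmetric := (hA.pow n).isSymmetric
    exact hsa.coe_re_inner_apply_self χ
  refine ⟨⟨?_⟩, hsupp, hmom⟩
  have h0 := hmom 0
  have h1 : ((1 : H →L[ℂ] H) χ) = χ := rfl
  simp only [pow_zero, h1, inner_self_eq_norm_sq_to_K, hχ1,
    integral_const, smul_eq_mul, mul_one] at h0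
  have h3 : (spectralMeasure A χ).real Set.univ = 1 := by
    have : (((spectralMeasure A χ).real Set.univ : ℝ) : ℂ) = ((1 : ℝ) : ℂ) := by
      rw [h0]
      simp
    exact_mod_cast this
  rw [measureReal_def] at h3
  exact (ENNReal.toReal_eq_one_iff _).mp h3

/-! ### The path tree -/

/-- The finite paths of `G` that start at `o`: an end vertex together with a path to it. -/
abbrev RootedPath {V : Type u} (G : SimpleGraph V) (o : V) : Type u := Σ v : V, G.Path o v

/-- The path `Q` is the path `P` prolonged by one edge at its end. -/
def IsExtension {V : Type u} {G : SimpleGraph V} {o : V} (P Q : RootedPath G o) : Prop :=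
  ∃ h : G.Adj P.1 Q.1, (Q.2 : G.Walk o Q.1) = (P.2 : G.Walk o P.1).concat h

/-- The path tree `T(G, o)`: two paths starting at `o` are adjacent when one of them is the other
one prolonged by one edge. -/
def pathTree {V : Type u} (G : SimpleGraph V) (o : V) : SimpleGraph (RootedPath G o) :=
  SimpleGraph.fromRel IsExtension

/-- The path with the single vertex `o`. -/
def trivialPath {V : Type u} (G : SimpleGraph V) (o : V) : RootedPath G o :=
  ⟨o, SimpleGraph.Path.nil⟩

theorem pathTree_adj {V : Type u} {G : SimpleGraph V} {o : V} {P Q : RootedPath G o} :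
    (pathTree G o).Adj P Q ↔ IsExtension P Q ∨ IsExtension Q P := by
  rw [pathTree, SimpleGraph.fromRel_adj]
  refine ⟨fun h => h.2, fun h => ⟨?_, h⟩⟩
  rintro rfl
  rcases h with ⟨h, _⟩ | ⟨h, _⟩ <;> exact h.ne rfl

theorem pathTree_boundedDegree {V : Type u} {G : SimpleGraph V} {D : ℕ}
    (hG : BoundedDegree G D) (o : V) : BoundedDegree (pathTree G o) D := by
  intro P
  have hmaps : Set.MapsTo (fun Q : RootedPath G o => Q.1) ((pathTree G o).neighborSet P)
      (G.neighborSet P.1) := by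
    intro Q hQ
    rcases pathTree_adj.mp hQ with ⟨h, _⟩ | ⟨h, _⟩
    · exact h
    · exact h.symm
  have hinj : Set.InjOn (fun Q : RootedPath G o => Q.1) ((pathTree G o).neighborSet P) := by
    rintro ⟨v, Q⟩ hQ ⟨w, R⟩ hR (hvw : v = w)
    subst hvw
    have hmem : ∀ S S' : G.Path o v, IsExtension P ⟨v, S⟩ → IsExtension ⟨v, S'⟩ P → False := by
      rintro ⟨S, hS⟩ S' ⟨h, e⟩ ⟨h', e'⟩
      simp only at e e'
      rw [e, SimpleGraph.Walk.concat_isPath_iff] at hS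
      apply hS.2
      rw [e']
      simp [SimpleGraph.Walk.support_concat]
    have hQR : (Q : G.Walk o v) = R := by
      rcases pathTree_adj.mp hQ with hQ' | hQ' <;> rcases pathTree_adj.mp hR with hR' | hR'
      · obtain ⟨_, e⟩ := hQ'
        obtain ⟨_, e'⟩ := hR'
        exact e.trans e'.symm
      · exact (hmem _ _ hQ' hR').elim
      · exact (hmem _ _ hR' hQ').elim
      · obtain ⟨h, e⟩ := hQ'
        obtain ⟨h', e'⟩ := hR'
        obtain ⟨_, e2⟩ := SimpleGraph.Walk.concat_inj (e.symm.trans e')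
        simpa using e2
    rw [Subtype.ext hQR]
  exact (Set.encard_le_encard_of_injOn hmaps hinj).trans (hG P.1)

/-! ### The matching measure -/

/-- The matching measure `ν_{G,o}` of the rooted graph `(G, o)`: the spectral measure of the
adjacency operator of the path tree `T(G, o)` at the characteristic vector of the path `o`. -/
def matchingMeasure {V : Type u} {G : SimpleGraph V} {D : ℕ} (hG : BoundedDegree G D) (o : V) :
    Measure ℝ :=
  spectralMeasure (adjOperator (pathTree_boundedDegree hG o)) (chi (trivialPath G o))

/-- The matching measure is a probability measure concentrated on `[-D, D]` whose moments are
`⟨Aⁿ χ_o, χ_o⟩`. -/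
theorem matchingMeasure_spec {V : Type u} {G : SimpleGraph V} {D : ℕ} (hG : BoundedDegree G D)
    (o : V) :
    IsProbabilityMeasure (matchingMeasure hG o) ∧
    matchingMeasure hG o (Set.Icc (-(D : ℝ)) D)ᶜ = 0 ∧
    ∀ n : ℕ, ((∫ x, x ^ n ∂(matchingMeasure hG o) : ℝ) : ℂ) =
      inner ℂ ((adjOperator (pathTree_boundedDegree hG o) ^ n) (chi (trivialPath G o)))
        (chi (trivialPath G o)) := by
  exact spectralMeasure_spec (adjOperator_isSelfAdjoint _) (norm_adjOperator_le _) (norm_chi _)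

/-! ### Essential vertices and critical graphs -/

/-- The vertex `o` is `θ`-essential in `G`. -/
def IsEssential {V : Type u} {G : SimpleGraph V} {D : ℕ} (hG : BoundedDegree G D) (θ : ℝ) (o : V) :
    Prop :=
  0 < matchingMeasure hG o {θ}

/-- The graph `G` is `θ`-critical: all of its vertices are `θ`-essential. -/
def IsCritical {V : Type u} {G : SimpleGraph V} {D : ℕ} (hG : BoundedDegree G D) (θ : ℝ) : Prop :=
  ∀ o : V, IsEssential hG θ o

end MatchingMeasure

end

/-! Let a(u) be the mass at θ of the matching measure of G at u, let a_{G-x}(u) be the same quantity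
for G - x, and let f_u be the projection of χ_u to the θ-eigenspace of the path tree at u, so that
a(u) = ‖f_u‖². The proof splits ‖f_u‖² by the end vertices of paths. If the paths from u to w
contribute a(u) a(w), then summation over w gives a(u) = a(u) Σ_w a(w), and a(u) ≠ 0 cancels
(`tsum_atom`).

The contribution of w comes from matching polynomials μ. For a finite vertex set F, the resolvent of
the path tree, applied to χ_u, has the value μ(F - P)/μ(F) at the path P (`smul_matchVec_sub`). The
Heilmann-Lieb identity μ(F - u) μ(F - w) - μ(F) μ(F - u - w) = Σ μ(F - P)², over the paths P from u
to w, is thus a statement about resolvents. It survives the limit F ↑ V by strong resolvent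
convergence. Multiplied by (iy)² at z = θ + iy, it becomes for y ↓ 0 the identity Σ f_u(P)² = a(u)
a(w) - a(u) a_{G-u}(w).

The last term vanishes by a version of Gallai's lemma (`atom_eq_zero_of_ne`). For w adjacent to u
this is the vertex recursion of the resolvent near its pole. It propagates along walks by a
polarised Heilmann-Lieb identity whose second factor lives on G - x (`two_mul_tsum_pathTerm`,
`atom_eq_zero_trans`).

All path trees are realised on ℓ² of lists of vertices, so that operators of different induced
subgraphs can be compared. `measure_singleton_eq` identifies ‖f_u‖² with the mass at θ of the
matching measure. -/

noncomputable section

open Filter Topology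

namespace MatchingMeasure

/-! ### Resolvents and eigenprojections of bounded self-adjoint operators -/

section Hilbert

variable {H : Type*} [NormedAddCommGroup H] [InnerProductSpace ℂ H] [CompleteSpace H]

/-- Since ⟨x, A x⟩ is real, ⟨x, (z - A) x⟩ has imaginary part Im z · ‖x‖², and Cauchy-Schwarz
applies. This one inequality yields both the resolvent bound and the uniqueness of solutions of (z -
A) y = x. -/
theorem abs_im_mul_norm_le {A : H →L[ℂ] H} (hA : IsSelfAdjoint A) (z : ℂ) (x : H) :
    |z.im| * ‖x‖ ≤ ‖z • x - A x‖ := by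
  rcases eq_or_ne x 0 with rfl | hx
  · simp
  have hx' : 0 < ‖x‖ := norm_pos_iff.mpr hx
  have him : (inner ℂ x (A x)).im = 0 := by
    exact hA.isSymmetric.im_inner_self_apply x
  have h1 : (inner ℂ x (z • x - A x)).im = z.im * ‖x‖ ^ 2 := by
    rw [inner_sub_right, inner_smul_right, Complex.sub_im, him, inner_self_eq_norm_sq_to_K, sub_zero]
    exact (congrArg (fun w : ℂ => (z * w).im) (Complex.ofReal_pow ‖x‖ 2).symm).trans
      (Complex.im_mul_ofReal _ _)
  have h2 : |z.im| * ‖x‖ ^ 2 ≤ ‖x‖ * ‖z • x - A x‖ := by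
    calc |z.im| * ‖x‖ ^ 2 = |(inner ℂ x (z • x - A x)).im| := by
          rw [h1, abs_mul, abs_of_nonneg (sq_nonneg ‖x‖)]
      _ ≤ ‖inner ℂ x (z • x - A x)‖ := Complex.abs_im_le_norm _
      _ ≤ _ := norm_inner_le_norm _ _
  nlinarith

theorem isUnit_algebraMap_sub {A : H →L[ℂ] H} (hA : IsSelfAdjoint A) {z : ℂ} (hz : z.im ≠ 0) :
    IsUnit (algebraMap ℂ (H →L[ℂ] H) z - A) := by
  rw [← spectrum.notMem_iff]
  intro h
  have := hA.mem_spectrum_eq_re h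
  exact hz (by rw [this]; simp)

theorem smul_resolvent_sub {A : H →L[ℂ] H} (hA : IsSelfAdjoint A) {z : ℂ} (hz : z.im ≠ 0) (x : H) :
    z • resolvent A z x - A (resolvent A z x) = x := by
  have h := Ring.mul_inverse_cancel _ (isUnit_algebraMap_sub hA hz)
  have h2 := congrArg (fun B : H →L[ℂ] H => B x) h
  simpa [resolvent, Algebra.algebraMap_eq_smul_one] using h2

theorem norm_resolvent_apply_le {A : H →L[ℂ] H} (hA : IsSelfAdjoint A) {z : ℂ} (hz : z.im ≠ 0)
    (x : H) : |z.im| * ‖resolvent A z x‖ ≤ ‖x‖ := by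
  simpa only [smul_resolvent_sub hA hz] using abs_im_mul_norm_le hA z (resolvent A z x)

theorem eq_resolvent {A : H →L[ℂ] H} (hA : IsSelfAdjoint A) {z : ℂ} (hz : z.im ≠ 0) {x y : H}
    (h : z • y - A y = x) : y = resolvent A z x := by
  have h1 := abs_im_mul_norm_le hA z (y - resolvent A z x)
  have h2 : z • (y - resolvent A z x) - A (y - resolvent A z x) = 0 := by
    rw [smul_sub, map_sub, sub_sub_sub_comm, h, smul_resolvent_sub hA hz, sub_self]
  rw [h2, norm_zero] at h1
  have h3 : 0 < |z.im| := abs_pos.mpr hz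
  have h4 : ‖y - resolvent A z x‖ = 0 := by
    by_contra h0
    have := norm_nonneg (y - resolvent A z x)
    have : 0 < ‖y - resolvent A z x‖ := lt_of_le_of_ne this (Ne.symm h0)
    nlinarith
  exact sub_eq_zero.mp (norm_eq_zero.mp h4)

/-- Strong convergence of self-adjoint operators implies strong convergence of the resolvents. -/
theorem tendsto_resolvent {ι : Type*} {l : Filter ι} {A : H →L[ℂ] H} {B : ι → H →L[ℂ] H}
    (hA : IsSelfAdjoint A) (hB : ∀ i, IsSelfAdjoint (B i))
    (h : ∀ x, Tendsto (fun i => B i x) l (𝓝 (A x))) {z : ℂ} (hz : z.im ≠ 0) (x : H) :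
    Tendsto (fun i => resolvent (B i) z x) l (𝓝 (resolvent A z x)) := by
  have h3 : 0 < |z.im| := abs_pos.mpr hz
  set y := resolvent A z x with hy
  -- Second resolvent identity: z - B i maps the difference of the two resolvent vectors to B i y -
  -- A y. The operators are compared at the fixed vector y only, so strong convergence suffices.
  have hb : ∀ i, ‖resolvent (B i) z x - y‖ ≤ |z.im|⁻¹ * ‖B i y - A y‖ := by
    intro i
    have h1 := abs_im_mul_norm_le (hB i) z (resolvent (B i) z x - y)
    have h2 : z • (resolvent (B i) z x - y) - B i (resolvent (B i) z x - y) = B i y - A y := by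
      rw [smul_sub, map_sub, sub_sub_sub_comm, smul_resolvent_sub (hB i) hz]
      nth_rewrite 1 [← smul_resolvent_sub hA hz x]
      rw [← hy]
      abel
    rw [h2] at h1
    rwa [inv_mul_eq_div, le_div_iff₀ h3, mul_comm]
  rw [tendsto_iff_norm_sub_tendsto_zero]
  refine squeeze_zero (fun _ => norm_nonneg _) hb ?_
  have h5 := (tendsto_iff_norm_sub_tendsto_zero.mp (h y)).const_mul (|z.im|⁻¹)
  simpa using h5

/-- The orthogonal projection onto the eigenspace of `A` at the real number `θ`. -/
def eigenProj (A : H →L[ℂ] H) (θ : ℝ) : H →L[ℂ] H :=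
  ((A - algebraMap ℂ (H →L[ℂ] H) θ : H →L[ℂ] H) : H →ₗ[ℂ] H).ker.starProjection

theorem apply_eigenProj (A : H →L[ℂ] H) (θ : ℝ) (x : H) :
    A (eigenProj A θ x) = (θ : ℂ) • eigenProj A θ x := by
  have h : eigenProj A θ x ∈ ((A - algebraMap ℂ (H →L[ℂ] H) θ : H →L[ℂ] H) : H →ₗ[ℂ] H).ker :=
    Submodule.starProjection_apply_mem _ x
  have h2 : A (eigenProj A θ x) - (θ : ℂ) • eigenProj A θ x = 0 := by
    simpa [Algebra.algebraMap_eq_smul_one] using h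
  exact sub_eq_zero.mp h2

theorem inner_eigenProj (A : H →L[ℂ] H) (θ : ℝ) (x : H) :
    inner ℂ x (eigenProj A θ x) = ((‖eigenProj A θ x‖ ^ 2 : ℝ) : ℂ) := by
  have h1 : eigenProj A θ (eigenProj A θ x) = eigenProj A θ x :=
    Submodule.starProjection_eq_self_iff.mpr (Submodule.starProjection_apply_mem _ x)
  have h2 : inner ℂ (eigenProj A θ x) (eigenProj A θ x) =
      inner ℂ x (eigenProj A θ (eigenProj A θ x)) :=
    Submodule.inner_starProjection_left_eq_right _ _ _
  rw [h1] at h2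
  rw [← h2, inner_self_eq_norm_sq_to_K]
  norm_cast

/-- The point of the upper half plane at height `y` above `θ`. -/
def above (θ y : ℝ) : ℂ := θ + y * Complex.I

theorem above_im (θ y : ℝ) : (above θ y).im = y := by simp [above]

theorem resolvent_above_eigenProj {A : H →L[ℂ] H} (hA : IsSelfAdjoint A) (θ : ℝ) {y : ℝ}
    (hy : y ≠ 0) (x : H) :
    (y * Complex.I : ℂ) • resolvent A (above θ y) (eigenProj A θ x) = eigenProj A θ x := by
  rw [← map_smul]
  refine (eq_resolvent hA (by rwa [above_im]) ?_).symm
  rw [apply_eigenProj, above, add_smul]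
  abel

theorem isSelfAdjoint_sub_algebraMap {A : H →L[ℂ] H} (hA : IsSelfAdjoint A) (θ : ℝ) :
    IsSelfAdjoint (A - algebraMap ℂ (H →L[ℂ] H) θ) := by
  refine hA.sub ?_
  rw [Algebra.algebraMap_eq_smul_one]
  exact IsSelfAdjoint.smul (by simp [isSelfAdjoint_iff]) (IsSelfAdjoint.one _)

/-- `iy (θ + iy - A)⁻¹` converges strongly to the projection onto the eigenspace at `θ`. -/
theorem tendsto_smul_resolvent {A : H →L[ℂ] H} (hA : IsSelfAdjoint A) (θ : ℝ) (x : H) :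
    Tendsto (fun y : ℝ => (y * Complex.I : ℂ) • resolvent A (above θ y) x) (𝓝[>] 0)
      (𝓝 (eigenProj A θ x)) := by
  set N : H →L[ℂ] H := A - algebraMap ℂ (H →L[ℂ] H) θ with hN
  have hNs : IsSelfAdjoint N := isSelfAdjoint_sub_algebraMap hA θ
  -- On the range of N the operators iyR, with R the resolvent, are of size O(y), because iyR(Nv) =
  -- iy(iyRv - v). They are contractions, which extends the convergence to the closure of the range.
  have key : ∀ w ∈ closure (Set.range N),
      Tendsto (fun y : ℝ => (y * Complex.I : ℂ) • resolvent A (above θ y) w) (𝓝[>] 0) (𝓝 0) := by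
    intro w hw
    rw [Metric.tendsto_nhds]
    intro ε hε
    obtain ⟨_, ⟨v, rfl⟩, hv⟩ := Metric.mem_closure_iff.mp hw (ε / 2) (by positivity)
    have hsmall : ∀ᶠ y : ℝ in 𝓝[>] 0, y * (2 * ‖v‖) < ε / 2 := by
      have : Tendsto (fun y : ℝ => y * (2 * ‖v‖)) (𝓝[>] 0) (𝓝 (0 * (2 * ‖v‖))) :=
        ((continuous_id.mul continuous_const).tendsto 0).mono_left nhdsWithin_le_nhds
      rw [zero_mul] at this
      exact this.eventually_lt_const (by positivity)
    filter_upwards [hsmall, self_mem_nhdsWithin] with y hy1 hy0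
    have hy0 : 0 < y := hy0
    have him : (above θ y).im ≠ 0 := by rw [above_im]; exact hy0.ne'
    have hcontr : ∀ u, ‖(y * Complex.I : ℂ) • resolvent A (above θ y) u‖ ≤ ‖u‖ := by
      intro u
      have := norm_resolvent_apply_le hA him u
      rw [above_im] at this
      simpa [norm_smul] using this
    have hNv : (y * Complex.I : ℂ) • resolvent A (above θ y) (N v) =
        (y * Complex.I : ℂ) • ((y * Complex.I : ℂ) • resolvent A (above θ y) v - v) := by
      congr 1
      symm
      rw [← map_smul]
      nth_rewrite 2 [eq_resolvent hA him (y := v) rfl]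
      rw [← map_sub]
      congr 1
      simp only [hN, above, Algebra.algebraMap_eq_smul_one, sub_apply,
        smul_apply, one_apply_eq_self]
      module
    rw [dist_zero_right]
    have hsplit : w = (w - N v) + N v := by abel
    rw [hsplit, map_add, smul_add]
    refine (norm_add_le _ _).trans_lt ?_
    have h1 := hcontr (w - N v)
    rw [← dist_eq_norm] at h1
    have h2 : ‖(y * Complex.I : ℂ) • resolvent A (above θ y) (N v)‖ ≤ y * (2 * ‖v‖) := by
      rw [hNv, norm_smul]
      have h3 : ‖(y * Complex.I : ℂ)‖ = y := by simp [abs_of_pos hy0]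
      rw [h3]
      gcongr
      refine (norm_sub_le _ _).trans ?_
      have := hcontr v
      linarith
    linarith
  have hperp : x - eigenProj A θ x ∈ closure (Set.range N) := by
    have h1 : x - eigenProj A θ x ∈ (N : H →ₗ[ℂ] H).kerᗮ :=
      Submodule.sub_starProjection_mem_orthogonal x
    have h2 : (N : H →ₗ[ℂ] H).kerᗮ = (N : H →ₗ[ℂ] H).range.topologicalClosure := by
      rw [← Submodule.orthogonal_orthogonal_eq_closure]
      congr 1
      ext v
      rw [Submodule.mem_orthogonal]
      constructor
      · intro hv u hu
        obtain ⟨u', rfl⟩ := hu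
        have : inner ℂ (N u') v = inner ℂ u' (N v) := hNs.isSymmetric u' v
        have hv' : N v = 0 := hv
        rw [hv', inner_zero_right] at this
        exact this
      · intro hv
        change N v = 0
        rw [← inner_self_eq_zero (𝕜 := ℂ)]
        rw [← hv (N (N v)) ⟨N v, rfl⟩]
        exact (hNs.isSymmetric (N v) v).symm
    rw [h2] at h1
    exact h1
  -- The operators iyR fix the θ-eigenspace pointwise, so the component of x in it is added back
  -- unchanged.
  have h0 := (key _ hperp).add_const (eigenProj A θ x)
  rw [zero_add] at h0
  refine h0.congr' ?_
  filter_upwards [self_mem_nhdsWithin] with y hy0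
  nth_rewrite 2 [← resolvent_above_eigenProj hA θ (ne_of_gt hy0) x]
  rw [← smul_add, ← map_add]
  congr 2
  abel

end Hilbert

/-! ### Path trees of induced subgraphs on the common vertex set of lists -/

section Lists

variable {V : Type*}

/-- The list `l` is a path of `G` with all its vertices in `W`. -/
def IsPathIn (G : SimpleGraph V) (W : Set V) (l : List V) : Prop :=
  l.IsChain G.Adj ∧ l.Nodup ∧ ∀ x ∈ l, x ∈ W

theorem isPathIn_cons_cons {G : SimpleGraph V} {W : Set V} {x a : V} {l : List V} :
    IsPathIn G W (x :: a :: l) ↔ G.Adj a x ∧ x ∈ W ∧ x ∉ a :: l ∧ IsPathIn G W (a :: l) := by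
  simp only [IsPathIn, List.isChain_cons_cons, List.nodup_cons (a := x),
    List.forall_mem_cons (a := x), G.adj_comm x a]
  tauto

theorem isPathIn_singleton {G : SimpleGraph V} {W : Set V} {x : V} :
    IsPathIn G W [x] ↔ x ∈ W := by
  simp [IsPathIn]

theorem IsPathIn.of_cons {G : SimpleGraph V} {W : Set V} {x : V} {l : List V}
    (h : IsPathIn G W (x :: l)) : IsPathIn G W l :=
  ⟨h.1.of_cons, h.2.1.of_cons, fun y hy => h.2.2 y (List.mem_cons_of_mem _ hy)⟩

/-- The list `l'` is a path in `W` that prolongs the nonempty list `l` by one vertex; lists are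
prolonged at their head. -/
def IsListExtension (G : SimpleGraph V) (W : Set V) (l l' : List V) : Prop :=
  l ≠ [] ∧ IsPathIn G W l' ∧ ∃ x, l' = x :: l

/-- The graph on lists of vertices in which two paths of `G` inside `W` are adjacent when one of
them prolongs the other by one vertex. Its component at `[u]` is the path tree of `G` restricted
to `W`. -/
def listGraph (G : SimpleGraph V) (W : Set V) : SimpleGraph (List V) :=
  SimpleGraph.fromRel (IsListExtension G W)

theorem listGraph_adj {G : SimpleGraph V} {W : Set V} {l l' : List V} :
    (listGraph G W).Adj l l' ↔ IsListExtension G W l l' ∨ IsListExtension G W l' l := by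
  rw [listGraph, SimpleGraph.fromRel_adj]
  refine ⟨fun h => h.2, fun h => ⟨?_, h⟩⟩
  rintro rfl
  rcases h with ⟨_, _, x, h⟩ | ⟨_, _, x, h⟩ <;> simpa using congrArg List.length h

theorem listGraph_adj_isPathIn {G : SimpleGraph V} {W : Set V} {l l' : List V}
    (h : (listGraph G W).Adj l l') : l ≠ [] ∧ IsPathIn G W l ∧ IsPathIn G W l' := by
  rcases listGraph_adj.mp h with ⟨h1, h2, x, rfl⟩ | ⟨h1, h2, x, rfl⟩
  · exact ⟨h1, h2.of_cons, h2⟩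
  · exact ⟨by simp, h2, h2.of_cons⟩

theorem listGraph_adj_cons {G : SimpleGraph V} {W : Set V} {a : V} {l l' : List V}
    (hl : IsPathIn G W (a :: l)) : (listGraph G W).Adj (a :: l) l' ↔
      (l ≠ [] ∧ l' = l) ∨ ∃ x, (G.Adj a x ∧ x ∈ W ∧ x ∉ a :: l) ∧ l' = x :: a :: l := by
  rw [listGraph_adj]
  constructor
  · rintro (⟨h1, h2, x, rfl⟩ | ⟨h1, h2, x, h⟩)
    · rw [isPathIn_cons_cons] at h2
      exact Or.inr ⟨x, ⟨h2.1, h2.2.1, h2.2.2.1⟩, rfl⟩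
    · obtain ⟨rfl, rfl⟩ := List.cons_eq_cons.mp h
      exact Or.inl ⟨h1, rfl⟩
  · rintro (⟨h1, rfl⟩ | ⟨x, h, rfl⟩)
    · exact Or.inr ⟨h1, hl, a, rfl⟩
    · exact Or.inl ⟨by simp, isPathIn_cons_cons.mpr ⟨h.1, h.2.1, h.2.2, hl⟩, x, rfl⟩

/-- A neighbour of `a :: l` is determined by its head, which is a neighbour of `a`: the head of the
parent `l` lies on the path, while the head of a child does not. -/
theorem listGraph_boundedDegree {G : SimpleGraph V} {D : ℕ} (hG : BoundedDegree G D)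
    (W : Set V) : BoundedDegree (listGraph G W) D := by
  intro l
  rcases ((listGraph G W).neighborSet l).eq_empty_or_nonempty with h | ⟨l₀, h⟩
  · simp [h]
  obtain ⟨hne, hl, -⟩ := listGraph_adj_isPathIn h
  obtain ⟨a, l, rfl⟩ := List.exists_cons_of_ne_nil hne
  have hsub : ∀ l' ∈ (listGraph G W).neighborSet (a :: l),
      ∃ x, G.Adj a x ∧ l'.head? = some x := by
    intro l' hl'
    rcases (listGraph_adj_cons hl).mp hl' with ⟨h1, rfl⟩ | ⟨x, h, rfl⟩
    · obtain ⟨b, l, rfl⟩ := List.exists_cons_of_ne_nil h1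
      exact ⟨b, (isPathIn_cons_cons.mp hl).1.symm, rfl⟩
    · exact ⟨x, h.1, rfl⟩
  have hmaps : Set.MapsTo (fun l' : List V => l'.head?)
      ((listGraph G W).neighborSet (a :: l)) (some '' G.neighborSet a) := by
    intro l' hl'
    obtain ⟨x, hx, h⟩ := hsub l' hl'
    exact ⟨x, hx, h.symm⟩
  have hinj : Set.InjOn (fun l' : List V => l'.head?)
      ((listGraph G W).neighborSet (a :: l)) := by
    intro l₁ h₁ l₂ h₂ (h : l₁.head? = l₂.head?)
    rcases (listGraph_adj_cons hl).mp h₁ with ⟨k1, rfl⟩ | ⟨x, k1, rfl⟩ <;>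
    rcases (listGraph_adj_cons hl).mp h₂ with ⟨k2, rfl⟩ | ⟨y, k2, rfl⟩
    · rfl
    · exact (k2.2.2 (List.mem_cons_of_mem _ (List.mem_of_head? h))).elim
    · exact (k1.2.2 (List.mem_cons_of_mem _ (List.mem_of_head? h.symm))).elim
    · obtain rfl : x = y := by simpa using h
      rfl
  refine (Set.encard_le_encard_of_injOn hmaps hinj).trans ?_
  exact (Set.encard_image_le _ _).trans (hG a)

/-- The adjacency operator of `listGraph G W`. -/
def listOp {G : SimpleGraph V} {D : ℕ} (hG : BoundedDegree G D) (W : Set V) :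
    lp (fun _ : List V => ℂ) 2 →L[ℂ] lp (fun _ : List V => ℂ) 2 :=
  adjOperator (listGraph_boundedDegree hG W)

theorem listOp_isSelfAdjoint {G : SimpleGraph V} {D : ℕ} (hG : BoundedDegree G D) (W : Set V) :
    IsSelfAdjoint (listOp hG W) :=
  adjOperator_isSelfAdjoint _

theorem listOp_apply_of_not {G : SimpleGraph V} {D : ℕ} (hG : BoundedDegree G D) {W : Set V}
    (f : lp (fun _ : List V => ℂ) 2) {l : List V} (hl : ¬ (l ≠ [] ∧ IsPathIn G W l)) :
    (listOp hG W f : List V → ℂ) l = 0 := by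
  rw [listOp, adjOperator_apply]
  refine Finset.sum_eq_zero fun l' hl' => ?_
  rw [BoundedDegree.mem_nbrs] at hl'
  have := listGraph_adj_isPathIn hl'
  exact (hl ⟨this.1, this.2.1⟩).elim

open Classical in
theorem listOp_apply_cons {G : SimpleGraph V} {D : ℕ} (hG : BoundedDegree G D) {W : Set V}
    (f : lp (fun _ : List V => ℂ) 2) {a : V} {l : List V} (hl : IsPathIn G W (a :: l)) :
    (listOp hG W f : List V → ℂ) (a :: l) = (if l = [] then 0 else f l) +
      ∑ x ∈ (hG.nbrs a).filter (fun x => x ∈ W ∧ x ∉ a :: l), f (x :: a :: l) := by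
  rw [listOp, adjOperator_apply]
  have hset : (listGraph_boundedDegree hG W).nbrs (a :: l) =
      (if l = [] then ∅ else {l}) ∪ ((hG.nbrs a).filter (fun x => x ∈ W ∧ x ∉ a :: l)).image
        (fun x => x :: a :: l) := by
    ext l'
    rw [BoundedDegree.mem_nbrs, listGraph_adj_cons hl]
    simp only [Finset.mem_union, Finset.mem_image, Finset.mem_filter, BoundedDegree.mem_nbrs,
      eq_comm (b := l')]
    by_cases h : l = []
    · simp [h]
    · simp [h]
  rw [hset, Finset.sum_union, Finset.sum_image]
  · congr 1
    by_cases h : l = [] <;> simp [h]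
  · intro x _ y _ h
    simpa using h
  · rw [Finset.disjoint_left]
    intro l' h1 h2
    by_cases h : l = []
    · simp [h] at h1
    · obtain ⟨x, _, rfl⟩ := Finset.mem_image.mp h2
      have h3 : x :: a :: l = l := by simpa [h] using h1
      have h4 := congrArg List.length h3
      simp only [List.length_cons] at h4
      omega

end Lists

/-! ### The matching polynomial by vertex expansion -/

section MatchSum

variable {V : Type*}

open Classical in
/-- The matching polynomial of the subgraph of `G` induced on the finite set `F`, evaluated at `z`,
defined by expansion at a vertex. -/
def matchSum (G : SimpleGraph V) (z : ℂ) (F : Finset V) : ℂ :=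
  if h : F.Nonempty then
    z * matchSum G z (F.erase h.choose) -
      ∑ x ∈ F.filter (G.Adj h.choose), matchSum G z ((F.erase h.choose).erase x)
  else 1
termination_by F.card
decreasing_by
  · exact Finset.card_lt_card (Finset.erase_ssubset h.choose_spec)
  · exact Finset.card_lt_card
      ((Finset.erase_subset _ _).trans_ssubset (Finset.erase_ssubset h.choose_spec))

theorem matchSum_empty (G : SimpleGraph V) (z : ℂ) : matchSum G z ∅ = 1 := by
  rw [matchSum]
  simp

open Classical in
/-- The expansion of the matching polynomial does not depend on the vertex. -/
theorem matchSum_expand (G : SimpleGraph V) (z : ℂ) (F : Finset V) {a : V} (ha : a ∈ F) :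
    matchSum G z F = z * matchSum G z (F.erase a) -
      ∑ x ∈ F.filter (G.Adj a), matchSum G z ((F.erase a).erase x) := by
  induction hn : F.card using Nat.strong_induction_on generalizing F a with
  | _ n ih =>
  subst hn
  -- Expanding at a and then, by induction, at b gives an expression symmetric in a and b. Hence the
  -- expansion at the vertex chosen in the definition agrees with the one at any other vertex.
  have key : ∀ a ∈ F, ∀ b ∈ F, a ≠ b → z * matchSum G z (F.erase a) -
      ∑ x ∈ F.filter (G.Adj a), matchSum G z ((F.erase a).erase x) =
      z * (z * matchSum G z ((F.erase a).erase b) -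
        ∑ y ∈ ((F.erase a).erase b), if G.Adj b y then
          matchSum G z (((F.erase a).erase b).erase y) else 0) -
      ((if G.Adj a b then matchSum G z ((F.erase a).erase b) else 0) +
        ∑ x ∈ ((F.erase a).erase b), if G.Adj a x then
          z * matchSum G z (((F.erase a).erase b).erase x) else 0) +
      ∑ x ∈ ((F.erase a).erase b), ∑ y ∈ ((F.erase a).erase b),
        if G.Adj a x ∧ G.Adj b y ∧ x ≠ y then
          matchSum G z ((((F.erase a).erase b).erase x).erase y) else 0 := by
    intro a ha b hb hab
    have hba : b ∈ F.erase a := Finset.mem_erase.mpr ⟨hab.symm, hb⟩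
    have h1 := ih _ (Finset.card_lt_card (Finset.erase_ssubset ha)) (F.erase a) hba rfl
    have h2 : ∀ x ∈ (F.erase a).erase b, matchSum G z ((F.erase a).erase x) =
        z * matchSum G z (((F.erase a).erase b).erase x) -
          ∑ y ∈ (F.erase a).erase b, if G.Adj b y ∧ x ≠ y then
            matchSum G z ((((F.erase a).erase b).erase x).erase y) else 0 := by
      intro x hx
      have hbx : b ∈ (F.erase a).erase x :=
        Finset.mem_erase.mpr ⟨(Finset.ne_of_mem_erase hx).symm, hba⟩
      rw [ih _ (Finset.card_lt_card ((Finset.erase_subset _ _).trans_ssubset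
        (Finset.erase_ssubset ha))) ((F.erase a).erase x) hbx rfl,
        Finset.erase_right_comm (a := x) (b := b), ← Finset.sum_filter]
      congr 1
      refine Finset.sum_congr ?_ fun _ _ => rfl
      ext y
      simp only [Finset.mem_filter, Finset.mem_erase]
      constructor
      · rintro ⟨⟨h1, h2, h3⟩, h4⟩
        exact ⟨⟨h4.ne', h2, h3⟩, h4, h1.symm⟩
      · rintro ⟨⟨h1, h2, h3⟩, h4, h5⟩
        exact ⟨⟨h5.symm, h2, h3⟩, h4⟩
    have h3 : ∀ (f : V → ℂ), ∑ x ∈ F.filter (G.Adj a), f x = (if G.Adj a b then f b else 0) +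
        ∑ x ∈ (F.erase a).erase b, if G.Adj a x then f x else 0 := by
      intro f
      rw [Finset.sum_filter, ← Finset.add_sum_erase F _ ha, ← Finset.add_sum_erase _ _ hba]
      simp
    have h4 : ∑ x ∈ (F.erase a).filter (G.Adj b),
        matchSum G z (((F.erase a).erase b).erase x) = ∑ y ∈ ((F.erase a).erase b),
          if G.Adj b y then matchSum G z (((F.erase a).erase b).erase y) else 0 := by
      rw [Finset.sum_filter, ← Finset.add_sum_erase _ _ hba]
      simp
    rw [h1, h3, h4]
    have h5 : ∑ x ∈ (F.erase a).erase b,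
        (if G.Adj a x then matchSum G z ((F.erase a).erase x) else 0) =
        ∑ x ∈ (F.erase a).erase b, ((if G.Adj a x then
          z * matchSum G z (((F.erase a).erase b).erase x) else 0) -
          ∑ y ∈ (F.erase a).erase b, if G.Adj a x ∧ G.Adj b y ∧ x ≠ y then
            matchSum G z ((((F.erase a).erase b).erase x).erase y) else 0) := by
      refine Finset.sum_congr rfl fun x hx => ?_
      by_cases hax : G.Adj a x
      · simp only [hax, if_true, true_and]
        exact h2 x hx
      · simp [hax]
    rw [h5, Finset.sum_sub_distrib]
    ring
  have hne : F.Nonempty := ⟨a, ha⟩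
  have hunf : matchSum G z F = z * matchSum G z (F.erase hne.choose) -
      ∑ x ∈ F.filter (G.Adj hne.choose), matchSum G z ((F.erase hne.choose).erase x) := by
    conv_lhs => rw [matchSum]
    rw [dif_pos hne]
  rw [hunf]
  by_cases hab : hne.choose = a
  · rw [hab]
  rw [key _ hne.choose_spec a ha hab, key a ha _ hne.choose_spec (Ne.symm hab),
    Finset.erase_right_comm (a := a)]
  set b := hne.choose
  have h6 : ∀ C : Finset V, ∀ c d : V, ∑ x ∈ C, (if G.Adj c x then z * matchSum G z (C.erase x)
      else 0) = z * ∑ x ∈ C, if G.Adj c x then matchSum G z (C.erase x) else 0 := by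
    intro C c d
    rw [Finset.mul_sum]
    exact Finset.sum_congr rfl fun x _ => by split_ifs <;> simp
  rw [h6 _ _ a, h6 _ _ a, G.adj_comm b a]
  have h7 : ∀ C : Finset V, ∑ x ∈ C, ∑ y ∈ C, (if G.Adj b x ∧ G.Adj a y ∧ x ≠ y then
      matchSum G z ((C.erase x).erase y) else 0) =
      ∑ x ∈ C, ∑ y ∈ C, (if G.Adj a x ∧ G.Adj b y ∧ x ≠ y then
      matchSum G z ((C.erase x).erase y) else 0) := by
    intro C
    rw [Finset.sum_comm]
    refine Finset.sum_congr rfl fun x _ => Finset.sum_congr rfl fun y _ => ?_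
    rw [Finset.erase_right_comm]
    congr 1
    simp only [eq_iff_iff, ne_comm (a := x)]
    tauto
  rw [h7]
  ring

end MatchSum

/-! ### Matching polynomials solve the resolvent equation of the path tree -/

section MatchVec

variable {V : Type*}

open Classical in
theorem chi_apply {ι : Type*} (v w : ι) : (chi v : ι → ℂ) w = if w = v then 1 else 0 := by
  simp [chi, Pi.single_apply]

theorem finite_isPathIn (G : SimpleGraph V) (F : Finset V) :
    {l : List V | IsPathIn G F l}.Finite := by
  classical
  have h : ∀ n : ℕ, {l : List V | (∀ x ∈ l, x ∈ F) ∧ l.length ≤ n}.Finite := by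
    intro n
    refine ((List.finite_length_le F n).image (List.map Subtype.val)).subset ?_
    rintro l ⟨h1, h2⟩
    exact ⟨l.attachWith (fun x => x ∈ F) h1, by simpa using h2, by simp⟩
  refine (h F.card).subset ?_
  rintro l ⟨-, h1, h2⟩
  refine ⟨fun x hx => Finset.mem_coe.mp (h2 x hx), ?_⟩
  rw [← List.toFinset_card_of_nodup h1]
  exact Finset.card_le_card fun x hx => Finset.mem_coe.mp (h2 x (List.mem_toFinset.mp hx))

open Classical in
/-- The value at the list `l` of the vector that solves `(z - A) ρ = μ(F, z) χ_u`, where `A` is the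
adjacency operator of the path tree of the induced subgraph on `F`. -/
def matchCoeff (G : SimpleGraph V) (z : ℂ) (F : Finset V) (u : V) (l : List V) : ℂ :=
  if IsPathIn G F l ∧ l.getLast? = some u then matchSum G z (F \ l.toFinset) else 0

theorem matchCoeff_of_not_isPathIn (G : SimpleGraph V) (z : ℂ) (F : Finset V) (u : V) {l : List V}
    (h : ¬ IsPathIn G F l) : matchCoeff G z F u l = 0 := by
  rw [matchCoeff, if_neg fun h' => h h'.1]

theorem finite_support_matchCoeff (G : SimpleGraph V) (z : ℂ) (F : Finset V) (u : V) :
    {l : List V | matchCoeff G z F u l ≠ 0}.Finite :=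
  (finite_isPathIn G F).subset fun _ hl => by
    by_contra h
    exact hl (matchCoeff_of_not_isPathIn G z F u h)

/-- The vector with coefficients `matchCoeff`. -/
def matchVec (G : SimpleGraph V) (z : ℂ) (F : Finset V) (u : V) :
    lp (fun _ : List V => ℂ) 2 :=
  ⟨matchCoeff G z F u, (memℓp_zero (finite_support_matchCoeff G z F u)).of_exponent_ge zero_le⟩

theorem matchVec_apply (G : SimpleGraph V) (z : ℂ) (F : Finset V) (u : V) (l : List V) :
    (matchVec G z F u : List V → ℂ) l = matchCoeff G z F u l := rfl

open Classical in
theorem matchCoeff_singleton (G : SimpleGraph V) (z : ℂ) {F : Finset V} {u : V} (hu : u ∈ F) :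
    matchCoeff G z F u [u] = matchSum G z (F.erase u) := by
  rw [matchCoeff, if_pos ⟨isPathIn_singleton.mpr hu, rfl⟩]
  congr 1
  ext x
  simp [and_comm]

/-- At a path P from u with end a, this is the expansion of the matching polynomial of (F - P) + a
at a: the parent of P carries that polynomial, the children carry the terms of the sum. The root has
no parent, and the missing term μ(F) is the right-hand side. -/
theorem smul_matchVec_sub {G : SimpleGraph V} {D : ℕ} (hG : BoundedDegree G D) (z : ℂ)
    {F : Finset V} {u : V} (hu : u ∈ F) :
    z • matchVec G z F u - listOp hG F (matchVec G z F u) = matchSum G z F • chi [u] := by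
  classical
  ext l
  simp only [lp.coeFn_sub, lp.coeFn_smul, Pi.sub_apply, Pi.smul_apply, smul_eq_mul, chi_apply,
    matchVec_apply]
  by_cases hl : IsPathIn G F l
  swap
  · have hlu : l ≠ [u] := by
      rintro rfl
      exact hl (isPathIn_singleton.mpr hu)
    rw [listOp_apply_of_not hG _ fun h => hl h.2, matchCoeff_of_not_isPathIn _ _ _ _ hl,
      if_neg hlu]
    simp
  cases l with
  | nil =>
    rw [listOp_apply_of_not hG _ fun h => h.1 rfl]
    simp [matchCoeff]
  | cons a l =>
  rw [listOp_apply_cons hG _ hl]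
  simp only [matchVec_apply]
  by_cases hlast : (a :: l).getLast? = some u
  swap
  · have hau : a :: l ≠ [u] := by
      intro h
      rw [h] at hlast
      exact hlast rfl
    have h1 : (if l = [] then 0 else matchCoeff G z F u l) = 0 := by
      cases l with
      | nil => rfl
      | cons b l =>
        rw [List.getLast?_cons_cons] at hlast
        simp [matchCoeff, hlast]
    have h2 : ∀ x, matchCoeff G z F u (x :: a :: l) = 0 := by
      intro x
      rw [matchCoeff, if_neg]
      rw [List.getLast?_cons_cons]
      exact fun h => hlast h.2
    rw [h1, Finset.sum_eq_zero fun x _ => h2 x, matchCoeff, if_neg fun h => hlast h.2, if_neg hau]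
    simp
  have haF : a ∈ F \ l.toFinset := by
    rw [Finset.mem_sdiff, List.mem_toFinset]
    exact ⟨hl.2.2 a List.mem_cons_self, (List.nodup_cons.mp hl.2.1).1⟩
  have hexp := matchSum_expand G z (F \ l.toFinset) haF
  have hera : (F \ l.toFinset).erase a = F \ (a :: l).toFinset := by
    ext x
    simp only [Finset.mem_erase, Finset.mem_sdiff, List.mem_toFinset, List.mem_cons]
    tauto
  have hsum : ∀ _ : DecidablePred fun x => x ∈ (F : Set V) ∧ x ∉ a :: l,
      ∑ x ∈ (hG.nbrs a).filter (fun x => x ∈ (F : Set V) ∧ x ∉ a :: l),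
      matchCoeff G z F u (x :: a :: l) = ∑ x ∈ (F \ l.toFinset).filter (G.Adj a),
        matchSum G z (((F \ l.toFinset).erase a).erase x) := by
    intro _
    refine Finset.sum_congr ?_ ?_
    · ext x
      simp only [Finset.mem_filter, BoundedDegree.mem_nbrs, Finset.mem_sdiff, List.mem_toFinset,
        List.mem_cons, Finset.mem_coe]
      constructor
      · tauto
      · rintro ⟨⟨h1, h2⟩, h3⟩
        exact ⟨h3, h1, by rintro (rfl | h); exacts [h3.ne rfl, h2 h]⟩
    · intro x hx
      simp only [Finset.mem_filter, Finset.mem_sdiff, List.mem_toFinset] at hx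
      have hxa : x ∉ a :: l := by
        rw [List.mem_cons]
        rintro (rfl | h)
        exacts [hx.2.ne rfl, hx.1.2 h]
      rw [matchCoeff, if_pos ⟨isPathIn_cons_cons.mpr ⟨hx.2, hx.1.1, hxa, hl⟩, by
        rwa [List.getLast?_cons_cons]⟩]
      congr 1
      ext y
      simp only [Finset.mem_erase, Finset.mem_sdiff, List.mem_toFinset, List.mem_cons]
      tauto
  have hval : matchCoeff G z F u (a :: l) = matchSum G z ((F \ l.toFinset).erase a) := by
    rw [matchCoeff, if_pos ⟨hl, hlast⟩, hera]
  rw [hsum, hval]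
  cases l with
  | nil =>
    have hau : a = u := by simpa using hlast
    subst hau
    simp only [List.toFinset_nil, Finset.sdiff_empty] at hexp ⊢
    simp [hexp]
  | cons b l =>
    have h1 : matchCoeff G z F u (b :: l) = matchSum G z (F \ (b :: l).toFinset) := by
      rw [matchCoeff, if_pos ⟨hl.of_cons, by rwa [List.getLast?_cons_cons] at hlast⟩]
    rw [if_neg (by simp), if_neg (by simp), h1, hexp]
    ring

/-- A zero of μ(F + u) off the real line would put `matchVec` in the kernel of z - A, which is
trivial for self-adjoint A. But the coefficient of `matchVec` at the root is μ(F), nonzero by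
induction. -/
theorem matchSum_ne_zero {G : SimpleGraph V} {D : ℕ} (hG : BoundedDegree G D) {z : ℂ}
    (hz : z.im ≠ 0) (F : Finset V) : matchSum G z F ≠ 0 := by
  classical
  induction F using Finset.induction_on with
  | empty => simp [matchSum_empty]
  | insert u F hu ih =>
    intro h0
    have h1 := smul_matchVec_sub hG z (Finset.mem_insert_self u F)
    rw [h0, zero_smul] at h1
    have h2 := eq_resolvent (listOp_isSelfAdjoint hG _) hz h1
    rw [map_zero] at h2
    have h3 := matchCoeff_singleton G z (Finset.mem_insert_self u F)
    rw [← matchVec_apply, h2, Finset.erase_insert hu] at h3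
    exact ih h3.symm

/-- The resolvent at `z` of the path tree of the subgraph of `G` induced on `W`, applied to the
characteristic vector of the root `u`. -/
def rootResolvent {G : SimpleGraph V} {D : ℕ} (hG : BoundedDegree G D) (z : ℂ) (W : Set V) (u : V) :
    lp (fun _ : List V => ℂ) 2 :=
  resolvent (listOp hG W) z (chi [u])

theorem matchVec_eq {G : SimpleGraph V} {D : ℕ} (hG : BoundedDegree G D) {z : ℂ}
    (hz : z.im ≠ 0) {F : Finset V} {u : V} (hu : u ∈ F) :
    matchVec G z F u = matchSum G z F • rootResolvent hG z F u := by
  rw [eq_resolvent (listOp_isSelfAdjoint hG _) hz (smul_matchVec_sub hG z hu), map_smul]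
  rfl

open Classical in
theorem matchSum_mul_rootResolvent {G : SimpleGraph V} {D : ℕ} (hG : BoundedDegree G D) {z : ℂ}
    (hz : z.im ≠ 0) {F : Finset V} {u : V} (hu : u ∈ F) :
    matchSum G z F * (rootResolvent hG z F u : List V → ℂ) [u] = matchSum G z (F.erase u) := by
  rw [← matchCoeff_singleton G z hu, ← matchVec_apply, matchVec_eq hG hz hu]
  rfl

end MatchVec

/-! ### The polarised Heilmann-Lieb identity -/

section PathSum

variable {V : Type*}

open Classical in
theorem matchCoeff_cons_cons (G : SimpleGraph V) (z : ℂ) {F : Finset V} {u w b : V} (hw : w ∈ F)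
    (l : List V) : matchCoeff G z F u (w :: b :: l) =
      if G.Adj w b then matchCoeff G z (F.erase w) u (b :: l) else 0 := by
  have hpath : IsPathIn G F (w :: b :: l) ↔
      G.Adj w b ∧ IsPathIn G ((F.erase w : Finset V) : Set V) (b :: l) := by
    rw [isPathIn_cons_cons, G.adj_comm b w]
    simp only [IsPathIn, Finset.coe_erase, Set.mem_sdiff, Set.mem_singleton_iff, Finset.mem_coe]
    constructor
    · rintro ⟨h1, h2, h3, h4, h5, h6⟩
      exact ⟨h1, h4, h5, fun x hx => ⟨h6 x hx, by rintro rfl; exact h3 hx⟩⟩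
    · rintro ⟨h1, h4, h5, h6⟩
      exact ⟨h1, hw, fun h => (h6 w h).2 rfl, h4, h5, fun x hx => (h6 x hx).1⟩
  simp only [matchCoeff, hpath, List.getLast?_cons_cons]
  by_cases h : G.Adj w b
  · simp only [h, true_and, if_true]
    have : F \ (w :: b :: l).toFinset = F.erase w \ (b :: l).toFinset := by
      ext x
      simp only [Finset.mem_erase, Finset.mem_sdiff, List.mem_toFinset, List.mem_cons]
      tauto
    rw [this]
  · simp [h]

open Classical in
/-- The product of the coefficients of `F` and of `F \ Z` at a list with head `w`. -/
def pathTerm (G : SimpleGraph V) (z : ℂ) (F Z : Finset V) (u w : V) (l : List V) : ℂ :=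
  if l.head? = some w then matchCoeff G z F u l * matchCoeff G z (F \ Z) u l else 0

theorem summable_pathTerm (G : SimpleGraph V) (z : ℂ) (F Z : Finset V) (u w : V) :
    Summable (pathTerm G z F Z u w) := by
  refine summable_of_hasFiniteSupport ((finite_support_matchCoeff G z F u).subset ?_)
  intro l hl h0
  apply hl
  simp [pathTerm, h0]

theorem tsum_pathTerm_of_mem (G : SimpleGraph V) (z : ℂ) (F : Finset V) {Z : Finset V} (u : V)
    {w : V} (hw : w ∈ Z) : ∑' l, pathTerm G z F Z u w l = 0 := by
  classical
  have h : ∀ l, pathTerm G z F Z u w l = 0 := by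
    intro l
    rw [pathTerm]
    split_ifs with h
    · rw [matchCoeff_of_not_isPathIn G z (F \ Z), mul_zero]
      intro hp
      have := hp.2.2 w (List.mem_of_head? h)
      simp [hw] at this
    · rfl
  simp [h]

open Classical in
theorem tsum_pathTerm_self (G : SimpleGraph V) (z : ℂ) {F Z : Finset V} {u : V}
    (hu : u ∈ F) (huZ : u ∉ Z) : ∑' l, pathTerm G z F Z u u l =
      matchSum G z (F.erase u) * matchSum G z (F.erase u \ Z) := by
  have hu' : u ∈ F \ Z := Finset.mem_sdiff.mpr ⟨hu, huZ⟩
  rw [tsum_eq_single [u]]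
  · rw [pathTerm, if_pos List.head?_cons, matchCoeff_singleton G z hu, matchCoeff_singleton G z hu',
      Finset.erase_sdiff_comm]
  -- A path without repeated vertices from u to u is trivial.
  · intro l hl
    rw [pathTerm]
    split_ifs with h
    · have : matchCoeff G z F u l = 0 := by
        rw [matchCoeff, if_neg]
        rintro ⟨h1, h2⟩
        cases l with
        | nil => simp at h
        | cons a l =>
        obtain rfl : a = u := by simpa using h
        cases l with
        | nil => exact hl rfl
        | cons b l =>
        rw [List.getLast?_cons_cons] at h2
        exact (List.nodup_cons.mp h1.2.1).1 (List.mem_of_getLast? h2)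
      rw [this, zero_mul]
    · rfl

open Classical in
-- A path from u to w ≠ u is a path in F - w from u to a neighbour x of w, followed by w, and both
-- coefficients are unchanged when w is moved from the path to the deleted set.
theorem tsum_pathTerm_cons (G : SimpleGraph V) (z : ℂ) {F Z : Finset V} {u w : V}
    (hw : w ∈ F) (hwZ : w ∉ Z) (huw : u ≠ w) : ∑' l, pathTerm G z F Z u w l =
      ∑ x ∈ F.filter (G.Adj w), ∑' l, pathTerm G z (F.erase w) Z u x l := by
  rw [← Summable.tsum_finsetSum fun x _ => summable_pathTerm G z (F.erase w) Z u x]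
  have hinj : Function.Injective (fun l : List V => w :: l) := fun _ _ h => (List.cons_eq_cons.mp h).2
  rw [← hinj.tsum_eq]
  · congr 1
    ext l
    have hw' : w ∈ F \ Z := Finset.mem_sdiff.mpr ⟨hw, hwZ⟩
    cases l with
    | nil =>
      have h0 : matchCoeff G z F u [w] = 0 := by
        rw [matchCoeff, if_neg]
        rintro ⟨-, h⟩
        exact huw (by simpa using h.symm)
      simp [pathTerm, h0]
    | cons b l =>
      simp only [pathTerm, List.head?_cons, if_true, Option.some_inj]
      rw [matchCoeff_cons_cons G z hw, matchCoeff_cons_cons G z hw', Finset.erase_sdiff_comm,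
        Finset.sum_ite_eq]
      by_cases hb : G.Adj w b
      · by_cases hbF : b ∈ F
        · simp [hb, hbF]
        · rw [if_pos hb, matchCoeff_of_not_isPathIn G z (F.erase w)]
          · simp
          · intro h
            have := h.2.2 b List.mem_cons_self
            simp [hbF] at this
      · simp [hb]
  · intro l hl
    cases l with
    | nil => simp [pathTerm] at hl
    | cons a l =>
      by_cases h : a = w
      · exact ⟨l, by rw [h]⟩
      · simp [pathTerm, h] at hl

open Classical in
/-- The polarised Christoffel-Darboux type identity of Heilmann and Lieb. For `Z = ∅` it expresses
`μ(F - u) μ(F - w) - μ(F) μ(F - u - w)` as the sum of `μ(F - P)²` over the paths `P` from `u` to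
`w`. -/
theorem two_mul_tsum_pathTerm (G : SimpleGraph V) (z : ℂ) (F : Finset V) {Z : Finset V}
    (hZ : ∀ x ∈ Z, Z = {x}) {u w : V} (hu : u ∈ F) (hw : w ∈ F) (huw : u ≠ w) (huZ : u ∉ Z)
    (hwZ : w ∉ Z) : 2 * ∑' l, pathTerm G z F Z u w l =
      matchSum G z (F.erase u) * matchSum G z (F.erase w \ Z) +
      matchSum G z (F.erase u \ Z) * matchSum G z (F.erase w) -
      matchSum G z F * matchSum G z ((F.erase w).erase u \ Z) -
      matchSum G z (F \ Z) * matchSum G z ((F.erase w).erase u) := by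
  induction hn : F.card using Nat.strong_induction_on generalizing F w with
  | _ n ih =>
  subst hn
  set C := F.erase w with hC
  have huC : u ∈ C := Finset.mem_erase.mpr ⟨huw, hu⟩
  have hcomm : ∀ (X : Finset V) (x : V), (X \ Z).erase x = X.erase x \ Z :=
    fun X x => (Finset.erase_sdiff_comm X Z x).symm
  have e1 := matchSum_expand G z F hw
  rw [← hC] at e1
  have e2 : matchSum G z (F \ Z) = z * matchSum G z (C \ Z) -
      ∑ x ∈ F.filter (G.Adj w), if x ∉ Z then matchSum G z (C.erase x \ Z) else 0 := by
    rw [matchSum_expand G z (F \ Z) (Finset.mem_sdiff.mpr ⟨hw, hwZ⟩), hcomm,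
      ← hC, ← Finset.sum_filter]
    congr 1
    refine Finset.sum_congr ?_ fun x _ => by rw [hcomm]
    ext x
    simp only [Finset.mem_filter, Finset.mem_sdiff]
    tauto
  have e3 : matchSum G z (F.erase u) = z * matchSum G z (C.erase u) -
      ∑ x ∈ F.filter (G.Adj w), if x ≠ u then matchSum G z ((C.erase u).erase x) else 0 := by
    rw [matchSum_expand G z (F.erase u) (Finset.mem_erase.mpr ⟨huw.symm, hw⟩),
      Finset.erase_right_comm, ← hC, ← Finset.sum_filter]
    congr 1
    refine Finset.sum_congr ?_ fun x _ => rfl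
    ext x
    simp only [Finset.mem_filter, Finset.mem_erase]
    tauto
  have e4 : matchSum G z (F.erase u \ Z) = z * matchSum G z (C.erase u \ Z) -
      ∑ x ∈ F.filter (G.Adj w),
        if x ≠ u ∧ x ∉ Z then matchSum G z ((C.erase u).erase x \ Z) else 0 := by
    rw [matchSum_expand G z (F.erase u \ Z)
      (Finset.mem_sdiff.mpr ⟨Finset.mem_erase.mpr ⟨huw.symm, hw⟩, hwZ⟩), hcomm,
      Finset.erase_right_comm, ← hC, ← Finset.sum_filter]
    congr 1
    refine Finset.sum_congr ?_ fun x _ => by rw [hcomm]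
    ext x
    simp only [Finset.mem_filter, Finset.mem_erase, Finset.mem_sdiff]
    tauto
  -- One formula covers every neighbour x of w, so that it can be summed against the expansions `e1`
  -- to `e4`. For x = u only the trivial path counts. For x ∈ Z there is no path on the left, and
  -- the right side cancels precisely because Z = {x}. Otherwise it is the induction hypothesis for
  -- F - w.
  have hx : ∀ x ∈ F.filter (G.Adj w), 2 * ∑' l, pathTerm G z C Z u x l =
      -(if x ≠ u then matchSum G z ((C.erase u).erase x) else 0) * matchSum G z (C \ Z) -
      (if x ≠ u ∧ x ∉ Z then matchSum G z ((C.erase u).erase x \ Z) else 0) * matchSum G z C +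
      matchSum G z (C.erase x) * matchSum G z (C.erase u \ Z) +
      (if x ∉ Z then matchSum G z (C.erase x \ Z) else 0) * matchSum G z (C.erase u) := by
    intro x hx
    rw [Finset.mem_filter] at hx
    have hxC : x ∈ C := Finset.mem_erase.mpr ⟨hx.2.ne', hx.1⟩
    by_cases hxu : x = u
    · subst hxu
      rw [tsum_pathTerm_self G z huC huZ]
      simp only [ne_eq, not_true, if_false, false_and, huZ, not_false_eq_true, if_true]
      ring
    by_cases hxZ : x ∈ Z
    · rw [tsum_pathTerm_of_mem G z C u hxZ, hZ x hxZ]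
      simp only [ne_eq, hxu, Finset.mem_singleton, not_true, not_false_eq_true, if_true, if_false,
        and_false, ← Finset.erase_eq]
      ring
    · rw [ih _ (Finset.card_lt_card (Finset.erase_ssubset hw)) C huC hxC (Ne.symm hxu) hxZ rfl]
      simp only [ne_eq, hxu, hxZ, not_false_eq_true, if_true, and_self]
      rw [Finset.erase_right_comm (a := u) (b := x)]
      ring
  rw [tsum_pathTerm_cons G z hw hwZ huw, ← hC, Finset.mul_sum, Finset.sum_congr rfl hx,
    Finset.sum_add_distrib, Finset.sum_add_distrib, Finset.sum_sub_distrib, ← Finset.sum_mul,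
    ← Finset.sum_mul, ← Finset.sum_mul, ← Finset.sum_mul, Finset.sum_neg_distrib, e1, e2, e3, e4]
  ring

end PathSum

/-! ### Bilinear pairings and strong convergence on ℓ² -/

section Pairing

variable {ι : Type*}

theorem sum_norm_sq_indicator_le (s : Set ι) (f : lp (fun _ : ι => ℂ) 2) (t : Finset ι) :
    ∑ i ∈ t, ‖s.indicator f i‖ ^ (2 : ENNReal).toReal ≤ ‖f‖ ^ (2 : ENNReal).toReal := by
  refine le_trans (Finset.sum_le_sum fun i _ => ?_)
    (lp.sum_rpow_le_norm_rpow (p := 2) (by simp) f t)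
  gcongr
  exact norm_indicator_le_norm_self _ _

/-- The restriction of a vector of `ℓ²` to a set of indices. -/
def lpRestrict (s : Set ι) : lp (fun _ : ι => ℂ) 2 →L[ℂ] lp (fun _ : ι => ℂ) 2 :=
  LinearMap.mkContinuous
    { toFun := fun f => ⟨s.indicator f, memℓp_gen' (sum_norm_sq_indicator_le s f)⟩
      map_add' := by
        intro f g
        ext i
        exact congrFun (Set.indicator_add s (f : ι → ℂ) g) i
      map_smul' := by
        intro c f
        ext i
        exact congrFun (Set.indicator_const_smul s c (f : ι → ℂ)) i }
    1
    (fun f => by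
      rw [one_mul]
      exact lp.norm_le_of_forall_sum_le (by simp) (norm_nonneg f) (sum_norm_sq_indicator_le s f))

theorem lpRestrict_apply (s : Set ι) (f : lp (fun _ : ι => ℂ) 2) (i : ι) :
    (lpRestrict s f : ι → ℂ) i = s.indicator f i := rfl

/-- The bilinear sum of `f i * g i` over `i ∈ s`. -/
def pairing (s : Set ι) (f g : lp (fun _ : ι => ℂ) 2) : ℂ :=
  -- The conjugation makes the form bilinear: resolvent entries at non-real z are multiplied without
  -- conjugates. Continuity is inherited from the inner product.
  inner ℂ (star (lpRestrict s f)) g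

theorem hasSum_pairing (s : Set ι) (f g : lp (fun _ : ι => ℂ) 2) :
    HasSum (s.indicator fun i => f i * g i) (pairing s f g) := by
  have e : (s.indicator fun i => f i * g i) = fun i => inner ℂ (star (lpRestrict s f) i) (g i) := by
    funext i
    by_cases h : i ∈ s <;> simp [lpRestrict_apply, h, mul_comm]
  rw [e]
  exact lp.hasSum_inner (𝕜 := ℂ) (star (lpRestrict s f)) g

theorem pairing_smul_smul (s : Set ι) (c d : ℂ) (f g : lp (fun _ : ι => ℂ) 2) :
    pairing s (c • f) (d • g) = c * d * pairing s f g := by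
  refine (hasSum_pairing s (c • f) (d • g)).unique ?_
  have e : (s.indicator fun i => (c • f) i * (d • g) i) =
      fun i => c * d * s.indicator (fun i => f i * g i) i := by
    funext i
    by_cases h : i ∈ s
    · simp only [h, Set.indicator_of_mem, lp.coeFn_smul, Pi.smul_apply, smul_eq_mul]
      ring
    · simp [h]
  rw [e]
  exact (hasSum_pairing s f g).mul_left (c * d)

theorem tendsto_pairing {α : Type*} {l : Filter α} (s : Set ι) {f g : α → lp (fun _ : ι => ℂ) 2}
    {f₀ g₀ : lp (fun _ : ι => ℂ) 2} (hf : Tendsto f l (𝓝 f₀)) (hg : Tendsto g l (𝓝 g₀)) :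
    Tendsto (fun a => pairing s (f a) (g a)) l (𝓝 (pairing s f₀ g₀)) :=
  Tendsto.inner (((lpRestrict s).continuous.tendsto f₀).comp hf).star hg

theorem tendsto_coord {α : Type*} {l : Filter α} (i : ι) {f : α → lp (fun _ : ι => ℂ) 2}
    {f₀ : lp (fun _ : ι => ℂ) 2} (hf : Tendsto f l (𝓝 f₀)) :
    Tendsto (fun a => (f a : ι → ℂ) i) l (𝓝 (f₀ i)) := by
  simp only [← inner_chi_left]
  exact tendsto_const_nhds.inner hf

/-- Uniformly bounded operators that converge at the characteristic vectors converge strongly. -/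
theorem tendsto_of_tendsto_chi {α : Type*} {l : Filter α}
    {A : lp (fun _ : ι => ℂ) 2 →L[ℂ] lp (fun _ : ι => ℂ) 2}
    {B : α → lp (fun _ : ι => ℂ) 2 →L[ℂ] lp (fun _ : ι => ℂ) 2} {C : ℝ}
    (hA : ‖A‖ ≤ C) (hB : ∀ a, ‖B a‖ ≤ C)
    (h : ∀ i, Tendsto (fun a => B a (chi i)) l (𝓝 (A (chi i)))) (f : lp (fun _ : ι => ℂ) 2) :
    Tendsto (fun a => B a f) l (𝓝 (A f)) := by
  classical
  have hC : 0 ≤ C := (norm_nonneg A).trans hA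
  rw [Metric.tendsto_nhds]
  intro ε hε
  have hs := lp.hasSum_single (E := fun _ : ι => ℂ) (p := 2) (by simp) f
  -- The finite truncation costs at most 2C ‖g - f‖, uniformly in the operator. The `+ 1` keeps the
  -- denominator positive when `C = 0`.
  obtain ⟨s, hs⟩ := (Metric.tendsto_nhds.mp hs (ε / (2 * (2 * C + 1))) (by positivity)).exists
  set g := ∑ i ∈ s, lp.single (E := fun _ : ι => ℂ) 2 i (f i) with hg
  have hgt : Tendsto (fun a => B a g) l (𝓝 (A g)) := by
    simp only [hg, map_sum]
    refine tendsto_finsetSum s fun i _ => ?_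
    have hchi : lp.single (E := fun _ : ι => ℂ) 2 i (f i) = f i • chi i := by
      rw [chi, ← lp.single_smul]
      simp
    simp only [hchi, map_smul]
    exact (h i).const_smul _
  filter_upwards [Metric.tendsto_nhds.mp hgt (ε / 2) (by positivity)] with a ha
  rw [dist_eq_norm] at ha hs ⊢
  have h1 : B a f - A f = (B a g - A g) - B a (g - f) + A (g - f) := by
    simp only [map_sub]
    abel
  rw [h1]
  have h2 := (B a).le_of_opNorm_le (hB a) (g - f)
  have h3 := A.le_of_opNorm_le hA (g - f)
  have h4 : (2 * C) * ‖g - f‖ ≤ ε / 2 := by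
    calc (2 * C) * ‖g - f‖ ≤ (2 * C + 1) * (ε / (2 * (2 * C + 1))) := by
          gcongr
          linarith
      _ = ε / 2 := by field_simp
  calc _ ≤ ‖B a g - A g‖ + ‖B a (g - f)‖ + ‖A (g - f)‖ :=
        (norm_add_le _ _).trans (add_le_add_left (norm_sub_le _ _) _)
    _ < ε := by linarith

end Pairing

/-! ### From finite induced subgraphs to the infinite graph -/

section Exhaustion

variable {V : Type*} {G : SimpleGraph V} {D : ℕ}

theorem isPathIn_inter {W F : Set V} {l : List V} :
    IsPathIn G (W ∩ F) l ↔ IsPathIn G W l ∧ ∀ x ∈ l, x ∈ F := by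
  simp only [IsPathIn, Set.mem_inter_iff]
  constructor
  · exact fun h => ⟨⟨h.1, h.2.1, fun x hx => (h.2.2 x hx).1⟩, fun x hx => (h.2.2 x hx).2⟩
  · exact fun h => ⟨h.1.1, h.1.2.1, fun x hx => ⟨h.1.2.2 x hx, h.2 x hx⟩⟩

theorem listGraph_inter_adj {W F : Set V} {l l' : List V} : (listGraph G (W ∩ F)).Adj l l' ↔
    (listGraph G W).Adj l l' ∧ (∀ x ∈ l, x ∈ F) ∧ ∀ x ∈ l', x ∈ F := by
  simp only [listGraph_adj, IsListExtension, isPathIn_inter]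
  constructor
  · rintro (⟨h1, ⟨h2, h3⟩, x, rfl⟩ | ⟨h1, ⟨h2, h3⟩, x, rfl⟩)
    · exact ⟨Or.inl ⟨h1, h2, x, rfl⟩, fun y hy => h3 y (List.mem_cons_of_mem _ hy), h3⟩
    · exact ⟨Or.inr ⟨h1, h2, x, rfl⟩, h3, fun y hy => h3 y (List.mem_cons_of_mem _ hy)⟩
  · rintro ⟨⟨h1, h2, h3⟩ | ⟨h1, h2, h3⟩, h4, h5⟩
    · exact Or.inl ⟨h1, ⟨h2, h5⟩, h3⟩
    · exact Or.inr ⟨h1, ⟨h2, h4⟩, h3⟩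

open Classical in
theorem adjOperator_chi {ι : Type*} {K : SimpleGraph ι} (hK : BoundedDegree K D) (i j : ι) :
    (adjOperator hK (chi i) : ι → ℂ) j = if K.Adj j i then 1 else 0 := by
  rw [adjOperator_apply]
  simp [chi_apply, hK.mem_nbrs]

theorem tendsto_listOp (hG : BoundedDegree G D) (W : Set V) (f : lp (fun _ : List V => ℂ) 2) :
    Tendsto (fun F : Finset V => listOp hG (W ∩ F) f) atTop (𝓝 (listOp hG W f)) := by
  classical
  refine tendsto_of_tendsto_chi (C := D) (norm_adjOperator_le _)
    (fun F => norm_adjOperator_le _) (fun l => ?_) f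
  refine tendsto_const_nhds.congr' ?_
  have hW := listGraph_boundedDegree hG W
  -- Once F contains the vertices of l and of all its neighbours, the two operators agree at the
  -- characteristic vector of l.
  filter_upwards [eventually_ge_atTop (l.toFinset ∪ (hW.nbrs l).biUnion List.toFinset)] with F hF
  ext l'
  simp only [adjOperator_chi, listGraph_inter_adj]
  refine if_congr ⟨fun h => ⟨h, fun x hx => hF ?_, fun x hx => hF ?_⟩, fun h => h.1⟩ rfl rfl
  · exact Finset.mem_union_right _ (Finset.mem_biUnion.mpr
      ⟨l', hW.mem_nbrs.mpr h.symm, List.mem_toFinset.mpr hx⟩)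
  · exact Finset.mem_union_left _ (List.mem_toFinset.mpr hx)

theorem tendsto_rootResolvent (hG : BoundedDegree G D) {z : ℂ} (hz : z.im ≠ 0) (W : Set V)
    (u : V) : Tendsto (fun F : Finset V => rootResolvent hG z (W ∩ F) u) atTop
      (𝓝 (rootResolvent hG z W u)) :=
  tendsto_resolvent (listOp_isSelfAdjoint hG W) (fun _ => listOp_isSelfAdjoint hG _)
    (tendsto_listOp hG W) hz _

/-- The diagonal entry at the root `u` of the resolvent of the path tree. -/
def rootEntry (hG : BoundedDegree G D) (z : ℂ) (W : Set V) (u : V) : ℂ :=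
  (rootResolvent hG z W u : List V → ℂ) [u]

theorem tendsto_rootEntry (hG : BoundedDegree G D) {z : ℂ} (hz : z.im ≠ 0) (W : Set V)
    (u : V) : Tendsto (fun F : Finset V => rootEntry hG z (W ∩ F) u) atTop
      (𝓝 (rootEntry hG z W u)) :=
  tendsto_coord _ (tendsto_rootResolvent hG hz W u)

open Classical in
theorem rootEntry_coe (hG : BoundedDegree G D) {z : ℂ} (hz : z.im ≠ 0) {F : Finset V} {u : V}
    (hu : u ∈ F) :
    rootEntry hG z F u = matchSum G z (F.erase u) / matchSum G z F := by
  rw [eq_div_iff (matchSum_ne_zero hG hz F), mul_comm]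
  exact matchSum_mul_rootResolvent hG hz hu

/-- For finite F both sides are μ(F - u - v)/μ(F), which is symmetric in u and v. -/
theorem rootEntry_mul_comm (hG : BoundedDegree G D) {z : ℂ} (hz : z.im ≠ 0) {u v : V}
    (huv : u ≠ v) : rootEntry hG z Set.univ u * rootEntry hG z (Set.univ \ {u}) v =
      rootEntry hG z Set.univ v * rootEntry hG z (Set.univ \ {v}) u := by
  classical
  refine tendsto_nhds_unique ((tendsto_rootEntry hG hz _ u).mul (tendsto_rootEntry hG hz _ v)) ?_
  refine ((tendsto_rootEntry hG hz _ v).mul (tendsto_rootEntry hG hz _ u)).congr' ?_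
  filter_upwards [eventually_ge_atTop {u, v}] with F hF
  have hu : u ∈ F := hF (by simp)
  have hv : v ∈ F := hF (by simp)
  have e : ∀ x, (Set.univ \ {x}) ∩ (F : Set V) = ((F.erase x : Finset V) : Set V) := by
    intro x
    ext y
    simp [and_comm]
  rw [Set.univ_inter, e, e, rootEntry_coe hG hz hu, rootEntry_coe hG hz hv,
    rootEntry_coe hG hz (Finset.mem_erase.mpr ⟨huv.symm, hv⟩),
    rootEntry_coe hG hz (Finset.mem_erase.mpr ⟨huv, hu⟩), Finset.erase_right_comm]
  have := matchSum_ne_zero hG hz (F.erase u)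
  have := matchSum_ne_zero hG hz (F.erase v)
  field_simp

/-- This is the limit of the expansion of μ(F) at u, divided by μ(F). -/
theorem rootEntry_mul_sub (hG : BoundedDegree G D) {z : ℂ} (hz : z.im ≠ 0) (u : V) :
    rootEntry hG z Set.univ u * (z - ∑ x ∈ hG.nbrs u, rootEntry hG z (Set.univ \ {u}) x) = 1 := by
  classical
  refine tendsto_nhds_unique ((tendsto_rootEntry hG hz _ u).mul (tendsto_const_nhds.sub
    (tendsto_finsetSum _ fun x _ => tendsto_rootEntry hG hz _ x))) ?_
  refine tendsto_const_nhds.congr' ?_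
  filter_upwards [eventually_ge_atTop (insert u (hG.nbrs u))] with F hF
  have hu : u ∈ F := hF (by simp)
  have e : (Set.univ \ {u}) ∩ (F : Set V) = ((F.erase u : Finset V) : Set V) := by
    ext y
    simp [and_comm]
  have hn : hG.nbrs u = F.filter (G.Adj u) := by
    ext x
    rw [Finset.mem_filter, hG.mem_nbrs]
    exact ⟨fun h => ⟨hF (Finset.mem_insert_of_mem (hG.mem_nbrs.mpr h)), h⟩, fun h => h.2⟩
  have hs : ∑ x ∈ hG.nbrs u, rootEntry hG z ((F.erase u : Finset V) : Set V) x =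
      (∑ x ∈ F.filter (G.Adj u), matchSum G z ((F.erase u).erase x)) /
        matchSum G z (F.erase u) := by
    rw [Finset.sum_div, ← hn]
    refine Finset.sum_congr rfl fun x hx => rootEntry_coe hG hz ?_
    exact Finset.mem_erase.mpr ⟨(hG.mem_nbrs.mp hx).ne', hF (Finset.mem_insert_of_mem hx)⟩
  rw [Set.univ_inter, e, hs, rootEntry_coe hG hz hu]
  have h1 := matchSum_ne_zero hG hz (F.erase u)
  have h2 := matchSum_ne_zero hG hz F
  have h3 := matchSum_expand G z F hu
  field_simp
  rw [h3, mul_comm]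

/-- The identity `two_mul_tsum_pathTerm` divided by μ(F) μ(F \ Z). The ratios with two deleted
vertices are written as products of root entries, because these have limits as F grows. -/
theorem two_mul_pairing_rootResolvent (hG : BoundedDegree G D) {z : ℂ} (hz : z.im ≠ 0)
    {Z : Finset V} (hZ : ∀ x ∈ Z, Z = {x}) {u w : V} (huw : u ≠ w) (huZ : u ∉ Z) (hwZ : w ∉ Z) :
    2 * pairing {l | l.head? = some w} (rootResolvent hG z Set.univ u)
        (rootResolvent hG z (Set.univ \ (Z : Set V)) u) =
      rootEntry hG z Set.univ u * rootEntry hG z (Set.univ \ (Z : Set V)) w +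
      rootEntry hG z (Set.univ \ (Z : Set V)) u * rootEntry hG z Set.univ w -
      rootEntry hG z Set.univ u * rootEntry hG z (Set.univ \ {u}) w -
      rootEntry hG z (Set.univ \ (Z : Set V)) u *
        rootEntry hG z ((Set.univ \ (Z : Set V)) \ {u}) w := by
  classical
  have T := fun (W : Set V) (v : V) => tendsto_rootEntry hG hz W v
  refine tendsto_nhds_unique ((tendsto_pairing _ (tendsto_rootResolvent hG hz _ u)
    (tendsto_rootResolvent hG hz _ u)).const_mul 2) ?_
  refine (((((T _ u).mul (T _ w)).add ((T _ u).mul (T _ w))).sub ((T _ u).mul (T _ w))).sub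
    ((T _ u).mul (T _ w))).congr' ?_
  filter_upwards [eventually_ge_atTop {u, w}] with F hF
  have hu : u ∈ F := hF (by simp)
  have hw : w ∈ F := hF (by simp)
  have huF : u ∈ F \ Z := Finset.mem_sdiff.mpr ⟨hu, huZ⟩
  have hwF : w ∈ F \ Z := Finset.mem_sdiff.mpr ⟨hw, hwZ⟩
  have e1 : (Set.univ \ {u}) ∩ (F : Set V) = ((F.erase u : Finset V) : Set V) := by
    ext y
    simp [and_comm]
  have e2 : (Set.univ \ (Z : Set V)) ∩ (F : Set V) = ((F \ Z : Finset V) : Set V) := by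
    ext y
    simp [and_comm]
  have e3 : ((Set.univ \ (Z : Set V)) \ {u}) ∩ (F : Set V) =
      (((F \ Z).erase u : Finset V) : Set V) := by
    ext y
    simp only [Set.mem_inter_iff, Set.mem_sdiff, Set.mem_univ, true_and, Finset.mem_coe,
      Set.mem_singleton_iff, Finset.mem_erase, Finset.mem_sdiff]
    tauto
  have hp : ∑' l, pathTerm G z F Z u w l = matchSum G z F * matchSum G z (F \ Z) *
      pairing {l | l.head? = some w} (rootResolvent hG z F u)
        (rootResolvent hG z ((F \ Z : Finset V) : Set V) u) := by
    rw [← pairing_smul_smul, ← matchVec_eq hG hz hu, ← matchVec_eq hG hz huF]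
    refine (HasSum.tsum_eq ?_)
    convert hasSum_pairing {l : List V | l.head? = some w} (matchVec G z F u)
      (matchVec G z (F \ Z) u) using 1
    funext l
    by_cases h : l.head? = some w <;> simp [pathTerm, h, matchVec_apply]
  have hid := two_mul_tsum_pathTerm G z F hZ hu hw huw huZ hwZ
  have hcomm : ∀ (X : Finset V) (x : V), X.erase x \ Z = (X \ Z).erase x :=
    fun X x => Finset.erase_sdiff_comm X Z x
  rw [hp] at hid
  simp only [hcomm] at hid
  rw [Set.univ_inter, e1, e2, e3, rootEntry_coe hG hz hu, rootEntry_coe hG hz hw,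
    rootEntry_coe hG hz huF, rootEntry_coe hG hz hwF,
    rootEntry_coe hG hz (Finset.mem_erase.mpr ⟨huw.symm, hw⟩),
    rootEntry_coe hG hz (Finset.mem_erase.mpr ⟨huw.symm, hwF⟩),
    Finset.erase_right_comm (a := u) (b := w), Finset.erase_right_comm (a := u) (b := w)]
  have h1 := matchSum_ne_zero hG hz (F.erase u)
  have h2 := matchSum_ne_zero hG hz F
  have h3 := matchSum_ne_zero hG hz (F \ Z)
  have h4 := matchSum_ne_zero hG hz ((F \ Z).erase u)
  field_simp
  linear_combination -hid

end Exhaustion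

/-! ### Masses at θ, Gallai's lemma and the summation -/

section Atoms

variable {V : Type*} {G : SimpleGraph V} {D : ℕ}

/-- The projection of the characteristic vector of the root `u` to the `θ`-eigenspace of the path
tree of the subgraph of `G` induced on `W`. -/
def eigenVec (hG : BoundedDegree G D) (θ : ℝ) (W : Set V) (u : V) :
    lp (fun _ : List V => ℂ) 2 :=
  eigenProj (listOp hG W) θ (chi [u])

/-- The mass at `θ` of the spectral measure of the path tree of the subgraph of `G` induced on `W`
at the root `u`. -/
def atom (hG : BoundedDegree G D) (θ : ℝ) (W : Set V) (u : V) : ℝ :=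
  ‖eigenVec hG θ W u‖ ^ 2

theorem atom_nonneg (hG : BoundedDegree G D) (θ : ℝ) (W : Set V) (u : V) : 0 ≤ atom hG θ W u :=
  sq_nonneg _

theorem eigenVec_root (hG : BoundedDegree G D) (θ : ℝ) (W : Set V) (u : V) :
    (eigenVec hG θ W u : List V → ℂ) [u] = atom hG θ W u := by
  rw [← inner_chi_left, eigenVec, inner_eigenProj]
  rfl

theorem eigenVec_eq_zero {hG : BoundedDegree G D} {θ : ℝ} {W : Set V} {u : V}
    (h : atom hG θ W u = 0) : eigenVec hG θ W u = 0 := by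
  simpa [atom] using h

theorem tendsto_smul_rootResolvent (hG : BoundedDegree G D) (θ : ℝ) (W : Set V) (u : V) :
    Tendsto (fun y : ℝ => (y * Complex.I : ℂ) • rootResolvent hG (above θ y) W u) (𝓝[>] 0)
      (𝓝 (eigenVec hG θ W u)) :=
  tendsto_smul_resolvent (listOp_isSelfAdjoint hG W) θ _

theorem tendsto_mul_rootEntry (hG : BoundedDegree G D) (θ : ℝ) (W : Set V) (u : V) :
    Tendsto (fun y : ℝ => (y * Complex.I : ℂ) * rootEntry hG (above θ y) W u) (𝓝[>] 0)
      (𝓝 (atom hG θ W u : ℂ)) := by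
  rw [← eigenVec_root]
  exact tendsto_coord [u] (tendsto_smul_rootResolvent hG θ W u)

theorem tendsto_mul_I : Tendsto (fun y : ℝ => (y * Complex.I : ℂ)) (𝓝[>] 0) (𝓝 0) := by
  have h : Continuous fun y : ℝ => (y * Complex.I : ℂ) := by fun_prop
  simpa using (h.tendsto 0).mono_left (nhdsWithin_le_nhds (s := Set.Ioi 0))

theorem above_im_ne_zero {θ y : ℝ} (hy : y ∈ Set.Ioi (0 : ℝ)) : (above θ y).im ≠ 0 := by
  rw [above_im]
  exact ne_of_gt hy

theorem atom_mul_comm (hG : BoundedDegree G D) (θ : ℝ) {u v : V} (huv : u ≠ v) :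
    atom hG θ Set.univ u * atom hG θ (Set.univ \ {u}) v =
      atom hG θ Set.univ v * atom hG θ (Set.univ \ {v}) u := by
  have T := tendsto_mul_rootEntry hG θ
  have h : ((atom hG θ Set.univ u : ℂ) * atom hG θ (Set.univ \ {u}) v) =
      atom hG θ Set.univ v * atom hG θ (Set.univ \ {v}) u := by
    refine tendsto_nhds_unique ((T _ u).mul (T _ v)) (((T _ v).mul (T _ u)).congr' ?_)
    filter_upwards [self_mem_nhdsWithin] with y hy
    have := rootEntry_mul_comm hG (above_im_ne_zero (θ := θ) hy) huv
    linear_combination (-(y * Complex.I : ℂ) ^ 2) * this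
  exact_mod_cast h

/-- In the vertex recursion multiplied by (iy)², both the right-hand side (iy)² and the contribution
iy · z of the linear term tend to 0, so only the products of masses remain. -/
theorem atom_mul_sum_nbrs (hG : BoundedDegree G D) (θ : ℝ) (u : V) :
    atom hG θ Set.univ u * ∑ x ∈ hG.nbrs u, atom hG θ (Set.univ \ {u}) x = 0 := by
  have T := tendsto_mul_rootEntry hG θ
  have hz : Tendsto (fun y : ℝ => above θ y) (𝓝[>] 0) (𝓝 (θ : ℂ)) := by
    simpa [above] using (tendsto_const_nhds (x := (θ : ℂ))).add tendsto_mul_I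
  have h : ((atom hG θ Set.univ u : ℂ) *
      (0 * θ - ∑ x ∈ hG.nbrs u, (atom hG θ (Set.univ \ {u}) x : ℂ))) = 0 ^ 2 := by
    refine tendsto_nhds_unique ((T _ u).mul ((tendsto_mul_I.mul hz).sub
      (tendsto_finsetSum _ fun x _ => T (Set.univ \ {u}) x))) ((tendsto_mul_I.pow 2).congr' ?_)
    filter_upwards [self_mem_nhdsWithin] with y hy
    have := rootEntry_mul_sub hG (above_im_ne_zero (θ := θ) hy) u
    rw [← Finset.mul_sum]
    linear_combination (-(y * Complex.I : ℂ) ^ 2) * this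
  have h' : ((atom hG θ Set.univ u * ∑ x ∈ hG.nbrs u, atom hG θ (Set.univ \ {u}) x : ℝ) : ℂ) = 0 := by
    push_cast
    linear_combination -h
  exact_mod_cast h'

theorem two_mul_pairing_eigenVec (hG : BoundedDegree G D) (θ : ℝ) {Z : Finset V}
    (hZ : ∀ x ∈ Z, Z = {x}) {u w : V} (huw : u ≠ w) (huZ : u ∉ Z) (hwZ : w ∉ Z) :
    2 * pairing {l | l.head? = some w} (eigenVec hG θ Set.univ u)
        (eigenVec hG θ (Set.univ \ (Z : Set V)) u) =
      (atom hG θ Set.univ u : ℂ) * atom hG θ (Set.univ \ (Z : Set V)) w +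
      atom hG θ (Set.univ \ (Z : Set V)) u * atom hG θ Set.univ w -
      atom hG θ Set.univ u * atom hG θ (Set.univ \ {u}) w -
      atom hG θ (Set.univ \ (Z : Set V)) u * atom hG θ ((Set.univ \ (Z : Set V)) \ {u}) w := by
  have T := tendsto_mul_rootEntry hG θ
  refine tendsto_nhds_unique ((tendsto_pairing _ (tendsto_smul_rootResolvent hG θ _ u)
    (tendsto_smul_rootResolvent hG θ _ u)).const_mul 2) ?_
  refine (((((T _ u).mul (T _ w)).add ((T _ u).mul (T _ w))).sub ((T _ u).mul (T _ w))).sub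
    ((T _ u).mul (T _ w))).congr' ?_
  filter_upwards [self_mem_nhdsWithin] with y hy
  have := two_mul_pairing_rootResolvent hG (above_im_ne_zero (θ := θ) hy) hZ huw huZ hwZ
  rw [pairing_smul_smul]
  linear_combination (-(y * Complex.I : ℂ) ^ 2) * this

theorem atom_eq_zero_of_adj {hG : BoundedDegree G D} {θ : ℝ} {u x : V}
    (hu : atom hG θ Set.univ u ≠ 0) (hux : G.Adj u x) : atom hG θ (Set.univ \ {u}) x = 0 := by
  have h := (mul_eq_zero.mp (atom_mul_sum_nbrs hG θ u)).resolve_left hu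
  rw [Finset.sum_eq_zero_iff_of_nonneg fun _ _ => atom_nonneg _ _ _ _] at h
  exact h x (hG.mem_nbrs.mpr hux)

/-- By `atom_mul_comm` the mass of G - x at u vanishes too, hence so does its whole eigenvector. In
the polarised identity with Z = {x} every term but a(u) a_{G-u}(w) is then zero. -/
theorem atom_eq_zero_trans {hG : BoundedDegree G D} {θ : ℝ} {u x w : V}
    (hu : atom hG θ Set.univ u ≠ 0) (hx : atom hG θ Set.univ x ≠ 0) (hux : u ≠ x) (hxw : x ≠ w)
    (huw : u ≠ w) (h1 : atom hG θ (Set.univ \ {u}) x = 0)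
    (h2 : atom hG θ (Set.univ \ {x}) w = 0) : atom hG θ (Set.univ \ {u}) w = 0 := by
  have h3 : atom hG θ (Set.univ \ {x}) u = 0 := by
    have := atom_mul_comm hG θ hux
    rw [h1, mul_zero] at this
    exact (mul_eq_zero.mp this.symm).resolve_left hx
  have h4 := two_mul_pairing_eigenVec hG θ (Z := {x}) (by simp) huw (by simpa using hux)
    (by simpa using hxw.symm)
  rw [Finset.coe_singleton, eigenVec_eq_zero h3, h2, h3] at h4
  have h5 : pairing {l : List V | l.head? = some w} (eigenVec hG θ Set.univ u) 0 = 0 :=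
    inner_zero_right _
  rw [h5] at h4
  have h6 : ((atom hG θ Set.univ u * atom hG θ (Set.univ \ {u}) w : ℝ) : ℂ) = 0 := by
    push_cast at h4 ⊢
    linear_combination h4
  have h7 : atom hG θ Set.univ u * atom hG θ (Set.univ \ {u}) w = 0 := by exact_mod_cast h6
  exact (mul_eq_zero.mp h7).resolve_left hu

/-- Gallai's lemma: in a connected critical graph, no vertex is essential after the removal of
another one. -/
theorem atom_eq_zero_of_ne {hG : BoundedDegree G D} {θ : ℝ} (hconn : G.Connected)
    (hcrit : ∀ u, atom hG θ Set.univ u ≠ 0) {u w : V} (huw : u ≠ w) :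
    atom hG θ (Set.univ \ {u}) w = 0 := by
  have key : ∀ w, Relation.ReflTransGen G.Adj u w → u ≠ w → atom hG θ (Set.univ \ {u}) w = 0 := by
    intro w h
    -- Induction along a walk from u. The walk may return to u, in which case the next vertex is
    -- again a neighbour of u.
    induction h with
    | refl => exact fun h => (h rfl).elim
    | @tail x w _ hxw ih =>
      intro huw
      by_cases hux : u = x
      · subst hux
        exact atom_eq_zero_of_adj (hcrit u) hxw
      · exact atom_eq_zero_trans (hcrit u) (hcrit x) hux hxw.ne huw (ih hux)
          (atom_eq_zero_of_adj (hcrit x) hxw)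
  exact key w ((G.reachable_iff_reflTransGen u w).mp (hconn.preconnected u w)) huw

theorem inner_star_star {ι : Type*} (f g : lp (fun _ : ι => ℂ) 2) :
    inner ℂ (star f) (star g) = star (inner ℂ f g) := by
  refine (lp.hasSum_inner (𝕜 := ℂ) (star f) (star g)).unique ?_
  have h := (lp.hasSum_inner (𝕜 := ℂ) f g).star
  simpa [mul_comm] using h

/-- The operator, the root vector and θ are all real, so the conjugate of the projection also
satisfies the characterisation of the projection. Reality turns the bilinear squares f(l)² of the
pairing into |f(l)|². -/
theorem star_eigenVec (hG : BoundedDegree G D) (θ : ℝ) (W : Set V) (u : V) :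
    star (eigenVec hG θ W u) = eigenVec hG θ W u := by
  have hA : ∀ f, listOp hG W (star f) = star (listOp hG W f) := by
    intro f
    ext l
    simp [listOp, adjOperator_apply]
  have hchi : star (chi [u]) = chi [u] := by
    ext l
    simp only [lp.coeFn_star, Pi.star_apply, chi_apply]
    split_ifs <;> simp
  have hker : ∀ f, f ∈ ((listOp hG W - algebraMap ℂ _ (θ : ℂ) :
      lp (fun _ : List V => ℂ) 2 →L[ℂ] _) : _ →ₗ[ℂ] lp (fun _ : List V => ℂ) 2).ker ↔
      listOp hG W f = (θ : ℂ) • f := by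
    intro f
    rw [← sub_eq_zero, Algebra.algebraMap_eq_smul_one]
    rfl
  have hstar : ∀ f, listOp hG W f = (θ : ℂ) • f → listOp hG W (star f) = (θ : ℂ) • star f := by
    intro f hf
    rw [hA, hf]
    simp
  symm
  refine Submodule.eq_starProjection_of_mem_of_inner_eq_zero ?_ ?_
  · rw [hker]
    exact hstar _ (apply_eigenProj _ _ _)
  · intro f hf
    rw [hker] at hf
    have h1 : inner ℂ (chi [u] - eigenVec hG θ W u) (star f) = 0 :=
      Submodule.starProjection_inner_eq_zero _ _ ((hker _).mpr (hstar f hf))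
    have h2 := inner_star_star (chi [u] - eigenVec hG θ W u) (star f)
    rw [h1, star_zero, star_sub, star_star, hchi] at h2
    exact h2

theorem eigenVec_mul_self (hG : BoundedDegree G D) (θ : ℝ) (W : Set V) (u : V) (l : List V) :
    eigenVec hG θ W u l * eigenVec hG θ W u l = ((‖eigenVec hG θ W u l‖ ^ 2 : ℝ) : ℂ) := by
  have h : star (eigenVec hG θ W u l) = eigenVec hG θ W u l := by
    rw [← lp.star_apply, star_eigenVec]
  have h2 := Complex.mul_conj' (eigenVec hG θ W u l)
  rw [← Complex.star_def, h] at h2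
  rw [h2]
  norm_cast

theorem eigenVec_eq_zero_of_not (hG : BoundedDegree G D) (θ : ℝ) {u : V} {l : List V}
    (hl : ¬ (IsPathIn G Set.univ l ∧ l.getLast? = some u)) :
    (eigenVec hG θ Set.univ u : List V → ℂ) l = 0 := by
  -- On finite sets the resolvent is a multiple of `matchVec`, which is supported on paths with root
  -- u; both limits preserve zero coordinates.
  have h1 : ∀ z : ℂ, z.im ≠ 0 → (rootResolvent hG z Set.univ u : List V → ℂ) l = 0 := by
    intro z hz
    refine tendsto_nhds_unique (tendsto_coord l (tendsto_rootResolvent hG hz Set.univ u)) ?_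
    refine tendsto_const_nhds.congr' ?_
    filter_upwards [eventually_ge_atTop {u}] with F hF
    have hu : u ∈ F := hF (by simp)
    have h2 := congrArg (fun f : lp (fun _ : List V => ℂ) 2 => (f : List V → ℂ) l)
      (matchVec_eq hG hz hu)
    have h3 : matchCoeff G z F u l = 0 := by
      rw [matchCoeff, if_neg]
      rintro ⟨⟨h3, h4, -⟩, h5⟩
      exact hl ⟨⟨h3, h4, fun _ _ => Set.mem_univ _⟩, h5⟩
    simp only [matchVec_apply, h3, lp.coeFn_smul, Pi.smul_apply, smul_eq_mul] at h2
    rw [Set.univ_inter]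
    exact ((mul_eq_zero.mp h2.symm).resolve_left (matchSum_ne_zero hG hz F)).symm
  refine tendsto_nhds_unique (tendsto_coord l (tendsto_smul_rootResolvent hG θ Set.univ u)) ?_
  refine tendsto_const_nhds.congr' ?_
  filter_upwards [self_mem_nhdsWithin] with y hy
  simp [h1 _ (above_im_ne_zero hy)]

theorem hasSum_indicator_norm_sq {hG : BoundedDegree G D} {θ : ℝ} (hconn : G.Connected)
    (hcrit : ∀ u, atom hG θ Set.univ u ≠ 0) (u w : V) :
    HasSum ({l : List V | l.head? = some w}.indicator
      fun l => ‖(eigenVec hG θ Set.univ u : List V → ℂ) l‖ ^ 2)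
      (atom hG θ Set.univ u * atom hG θ Set.univ w) := by
  by_cases huw : u = w
  · subst huw
    have hval : atom hG θ Set.univ u * atom hG θ Set.univ u = {l : List V | l.head? = some u}.indicator
        (fun l => ‖(eigenVec hG θ Set.univ u : List V → ℂ) l‖ ^ 2) [u] := by
      rw [Set.indicator_of_mem (by simp), eigenVec_root, Complex.norm_real, Real.norm_eq_abs,
        sq_abs, sq]
    rw [hval]
    refine hasSum_single [u] fun l hl => ?_
    by_cases hh : l.head? = some u
    · rw [Set.indicator_of_mem (by exact hh), eigenVec_eq_zero_of_not hG θ]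
      · simp
      · rintro ⟨h1, h2⟩
        cases l with
        | nil => simp at hh
        | cons a l =>
        obtain rfl : a = u := by simpa using hh
        cases l with
        | nil => exact hl rfl
        | cons b l =>
        rw [List.getLast?_cons_cons] at h2
        exact (List.nodup_cons.mp h1.2.1).1 (List.mem_of_getLast? h2)
    · rw [Set.indicator_of_notMem (by exact hh)]
  -- With Z = ∅ the two positive terms coincide, and the two negative ones vanish by Gallai's lemma.
  · have h1 := two_mul_pairing_eigenVec hG θ (Z := ∅) (by simp) huw (by simp) (by simp)
    rw [Finset.coe_empty, Set.sdiff_empty, atom_eq_zero_of_ne hconn hcrit huw] at h1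
    have h2 : pairing {l | l.head? = some w} (eigenVec hG θ Set.univ u)
        (eigenVec hG θ Set.univ u) =
        ((atom hG θ Set.univ u * atom hG θ Set.univ w : ℝ) : ℂ) := by
      push_cast at h1 ⊢
      linear_combination h1 / 2
    have h3 := hasSum_pairing {l | l.head? = some w} (eigenVec hG θ Set.univ u)
        (eigenVec hG θ Set.univ u)
    rw [h2] at h3
    rw [← Complex.hasSum_ofReal]
    have e : ({l : List V | l.head? = some w}.indicator fun l =>
        eigenVec hG θ Set.univ u l * eigenVec hG θ Set.univ u l) = fun l =>
        (({l : List V | l.head? = some w}.indicator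
          (fun l => ‖(eigenVec hG θ Set.univ u : List V → ℂ) l‖ ^ 2) l : ℝ) : ℂ) := by
      funext l
      by_cases hl : l ∈ {l : List V | l.head? = some w}
      · rw [Set.indicator_of_mem hl, Set.indicator_of_mem hl, eigenVec_mul_self]
      · rw [Set.indicator_of_notMem hl, Set.indicator_of_notMem hl, Complex.ofReal_zero]
    rw [← e]
    exact h3

theorem tsum_atom {hG : BoundedDegree G D} {θ : ℝ} (hconn : G.Connected)
    (hcrit : ∀ u, atom hG θ Set.univ u ≠ 0) :
    ∑' w, ENNReal.ofReal (atom hG θ Set.univ w) = 1 := by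
  classical
  obtain ⟨u⟩ := hconn.nonempty
  set f := eigenVec hG θ Set.univ u with hf
  have h1 : ∀ w, ENNReal.ofReal (atom hG θ Set.univ u) * ENNReal.ofReal (atom hG θ Set.univ w) =
      ∑' l : List V, if l.head? = some w then ENNReal.ofReal (‖f l‖ ^ 2) else 0 := by
    intro w
    have h := hasSum_indicator_norm_sq hconn hcrit u w
    rw [← ENNReal.ofReal_mul (atom_nonneg _ _ _ _), ← h.tsum_eq, ENNReal.ofReal_tsum_of_nonneg _ h.summable]
    · refine tsum_congr fun l => ?_
      by_cases hl : l.head? = some w <;> simp [hl, hf]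
    · exact fun l => Set.indicator_nonneg (fun _ _ => sq_nonneg _) _
  -- Each nonempty list is counted for exactly one end vertex; at the empty list the eigenvector
  -- vanishes.
  have h2 : ∀ l : List V, (∑' w, if l.head? = some w then ENNReal.ofReal (‖f l‖ ^ 2) else 0) =
      ENNReal.ofReal (‖f l‖ ^ 2) := by
    intro l
    cases l with
    | nil =>
      have : (f : List V → ℂ) [] = 0 := eigenVec_eq_zero_of_not hG θ (by simp)
      simp [this]
    | cons a l =>
      simp only [List.head?_cons, Option.some_inj, eq_comm (a := a)]
      exact tsum_ite_eq a (fun _ => ENNReal.ofReal (‖f (a :: l)‖ ^ 2))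
  have h3 : ∑' l, ENNReal.ofReal (‖f l‖ ^ 2) = ENNReal.ofReal (atom hG θ Set.univ u) := by
    have hs : HasSum (fun l => ‖f l‖ ^ 2) (‖f‖ ^ 2) := by
      have := lp.hasSum_norm (p := 2) (by simp) f
      simpa using this
    rw [← ENNReal.ofReal_tsum_of_nonneg (fun _ => sq_nonneg _) hs.summable, hs.tsum_eq]
    rfl
  have h4 : ENNReal.ofReal (atom hG θ Set.univ u) *
      ∑' w, ENNReal.ofReal (atom hG θ Set.univ w) = ENNReal.ofReal (atom hG θ Set.univ u) * 1 := by
    -- Sums in `ENNReal` may be interchanged without any summability condition.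
    rw [← ENNReal.tsum_mul_left, tsum_congr h1, ENNReal.tsum_comm, tsum_congr h2, h3, mul_one]
  refine (ENNReal.mul_right_inj ?_ ENNReal.ofReal_ne_top).mp h4
  exact (ENNReal.ofReal_pos.mpr (lt_of_le_of_ne (atom_nonneg _ _ _ _) (hcrit u).symm)).ne'

end Atoms

/-! ### Atoms of a spectral measure from its moments -/

section SpectralAtom

variable {H : Type*} [NormedAddCommGroup H] [InnerProductSpace ℂ H]

theorem inner_aeval_eq {A : H →L[ℂ] H} {x : H} {ν : Measure ℝ}
    (hint : ∀ n : ℕ, Integrable (fun t : ℝ => t ^ n) ν)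
    (hmom : ∀ n : ℕ, ((∫ t, t ^ n ∂ν : ℝ) : ℂ) = inner ℂ ((A ^ n) x) x) (p : Polynomial ℝ) :
    Integrable (fun t => p.eval t) ν ∧
      ((∫ t, p.eval t ∂ν : ℝ) : ℂ) = inner ℂ (Polynomial.aeval A p x) x := by
  induction p using Polynomial.induction_on' with
  | add p q hp hq =>
    simp only [Polynomial.eval_add, map_add, add_apply, inner_add_left]
    refine ⟨hp.1.add hq.1, ?_⟩
    rw [integral_add hp.1 hq.1, Complex.ofReal_add, hp.2, hq.2]
  | monomial n a =>
    simp only [Polynomial.eval_monomial]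
    refine ⟨(hint n).const_mul a, ?_⟩
    rw [integral_const_mul, Complex.ofReal_mul, hmom, Polynomial.aeval_monomial,
      Algebra.algebraMap_eq_smul_one, smul_one_mul]
    have : (a • A ^ n) x = (a : ℂ) • (A ^ n) x := rfl
    rw [this, inner_smul_left, Complex.conj_ofReal]

variable [CompleteSpace H]

/-- Expanding the square gives ‖v‖² - 2 s⁻² ‖Nv‖² + s⁻⁴ ‖N²v‖², and the last term is at most s⁻²
‖Nv‖² since ‖N‖ ≤ s. The contraction property is what the mean ergodic theorem requires. -/
theorem norm_sub_inv_sq_smul_le {N : H →L[ℂ] H} (hN : IsSelfAdjoint N) {s : ℝ} (hs : 0 < s)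
    (hNs : ‖N‖ ≤ s) : ‖1 - (s ^ 2)⁻¹ • (N * N)‖ ≤ 1 := by
  refine ContinuousLinearMap.opNorm_le_bound _ zero_le_one fun v => ?_
  rw [one_mul]
  refine le_of_sq_le_sq ?_ (norm_nonneg v)
  have h1 : (1 - (s ^ 2)⁻¹ • (N * N)) v = v - (((s ^ 2)⁻¹ : ℝ) : ℂ) • N (N v) := rfl
  have h2 : inner ℂ v (N (N v)) = ((‖N v‖ ^ 2 : ℝ) : ℂ) := by
    have : inner ℂ (N v) (N v) = inner ℂ v (N (N v)) := hN.isSymmetric v (N v)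
    rw [← this, inner_self_eq_norm_sq_to_K]
    norm_cast
  have h3 : ‖N (N v)‖ ≤ s * ‖N v‖ := N.le_of_opNorm_le hNs _
  rw [h1, @norm_sub_sq ℂ, inner_smul_right, h2, ← Complex.ofReal_mul, norm_smul,
    Complex.norm_real, Real.norm_of_nonneg (by positivity)]
  have h4 : RCLike.re ((((s ^ 2)⁻¹ * ‖N v‖ ^ 2 : ℝ) : ℂ)) = (s ^ 2)⁻¹ * ‖N v‖ ^ 2 :=
    Complex.ofReal_re _
  rw [h4]
  have h5 : ((s ^ 2)⁻¹ * ‖N (N v)‖) ^ 2 ≤ (s ^ 2)⁻¹ * ‖N v‖ ^ 2 := by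
    calc ((s ^ 2)⁻¹ * ‖N (N v)‖) ^ 2 ≤ ((s ^ 2)⁻¹ * (s * ‖N v‖)) ^ 2 := by gcongr
      _ = (s ^ 2)⁻¹ * ‖N v‖ ^ 2 := by field_simp
  have h6 : 0 ≤ (s ^ 2)⁻¹ * ‖N v‖ ^ 2 := by positivity
  linarith

theorem sub_inv_sq_smul_apply_eq_iff {N : H →L[ℂ] H} (hN : IsSelfAdjoint N) {s : ℝ} (hs : 0 < s)
    (v : H) : (1 - (s ^ 2)⁻¹ • (N * N)) v = v ↔ N v = 0 := by
  have h1 : (1 - (s ^ 2)⁻¹ • (N * N)) v = v - (s ^ 2)⁻¹ • N (N v) := rfl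
  rw [h1, sub_eq_self, smul_eq_zero_iff_right (by positivity)]
  constructor
  · intro h
    rw [← inner_self_eq_zero (𝕜 := ℂ)]
    have : inner ℂ (N v) (N v) = inner ℂ v (N (N v)) := hN.isSymmetric v (N v)
    rw [this, h, inner_zero_right]
  · intro h
    rw [h, map_zero]

/-- The mass at `θ` of the spectral measure of `A` at `x` is the squared norm of the projection of
`x` to the `θ`-eigenspace of `A`; the measure is given here by its moments. -/
theorem measure_singleton_eq {A : H →L[ℂ] H} (hA : IsSelfAdjoint A) {x : H} {D : ℝ}
    (hn : ‖A‖ ≤ D) {ν : Measure ℝ} [IsFiniteMeasure ν] (hsupp : ν (Set.Icc (-D) D)ᶜ = 0)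
    (hmom : ∀ n : ℕ, ((∫ t, t ^ n ∂ν : ℝ) : ℂ) = inner ℂ ((A ^ n) x) x) (θ : ℝ) :
    ν {θ} = ENNReal.ofReal (‖eigenProj A θ x‖ ^ 2) := by
  have hD : 0 ≤ D := (norm_nonneg A).trans hn
  have hae : ∀ᵐ t ∂ν, |t| ≤ D := by
    have : ∀ᵐ t ∂ν, t ∈ Set.Icc (-D) D := by
      rw [ae_iff]
      exact hsupp
    filter_upwards [this] with t ht using abs_le.mpr ht
  have hint : ∀ n : ℕ, Integrable (fun t : ℝ => t ^ n) ν := by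
    intro n
    refine Integrable.of_bound (by fun_prop) (D ^ n) ?_
    filter_upwards [hae] with t ht
    rw [norm_pow, Real.norm_eq_abs]
    gcongr
  set N : H →L[ℂ] H := A - algebraMap ℂ (H →L[ℂ] H) θ with hNdef
  have hN : IsSelfAdjoint N := isSelfAdjoint_sub_algebraMap hA θ
  -- This s bounds both ‖N‖ and |t - θ| on [-D, D]; the 1 makes it positive.
  set s : ℝ := D + |θ| + 1 with hs
  have hs0 : 0 < s := by positivity
  have hNs : ‖N‖ ≤ s := by
    refine ContinuousLinearMap.opNorm_le_bound _ hs0.le fun v => ?_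
    have h1 : N v = A v - (θ : ℂ) • v := by
      simp only [hNdef, Algebra.algebraMap_eq_smul_one]
      rfl
    rw [h1]
    calc ‖A v - (θ : ℂ) • v‖ ≤ ‖A v‖ + ‖(θ : ℂ) • v‖ := norm_sub_le _ _
      _ ≤ D * ‖v‖ + |θ| * ‖v‖ := by
          rw [norm_smul, Complex.norm_real, Real.norm_eq_abs]
          gcongr
          exact A.le_of_opNorm_le hn v
      _ ≤ s * ‖v‖ := by
          rw [hs]
          nlinarith [norm_nonneg v]
  set T : H →L[ℂ] H := 1 - (s ^ 2)⁻¹ • (N * N) with hT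
  -- On [-D, D] the polynomial q lies in [0, 1] and equals 1 only at θ. So ∫ qᵏ dν tends to ν{θ},
  -- while the integral is ⟨Tᵏ x, x⟩ with T = q(A).
  set q : Polynomial ℝ := 1 - (s ^ 2)⁻¹ • ((Polynomial.X - Polynomial.C θ) *
    (Polynomial.X - Polynomial.C θ)) with hq
  have hqT : Polynomial.aeval A q = T := by
    simp only [hq, hT, hNdef, map_sub, map_one, map_smul, map_mul, Polynomial.aeval_X,
      Polynomial.aeval_C]
    rfl
  have hqt : ∀ t, q.eval t = 1 - (s ^ 2)⁻¹ * ((t - θ) * (t - θ)) := by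
    intro t
    simp [hq]
  have hmomq : ∀ k : ℕ, ((∫ t, (q.eval t) ^ k ∂ν : ℝ) : ℂ) = inner ℂ (T^[k] x) x := by
    intro k
    have := (inner_aeval_eq hint hmom (q ^ k)).2
    rw [map_pow, hqT, FunLike.coe_pow_eq_iterate] at this
    simpa using this
  have hbound : ∀ t, |t| ≤ D → 0 ≤ q.eval t ∧ q.eval t ≤ 1 ∧ (t ≠ θ → q.eval t < 1) := by
    intro t ht
    have h1 : |t - θ| ≤ s := (abs_sub _ _).trans (by rw [hs]; linarith)
    have h2 : (t - θ) * (t - θ) ≤ s ^ 2 := by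
      rw [← sq]
      exact sq_le_sq' (by linarith [neg_abs_le (t - θ)]) ((le_abs_self _).trans h1)
    have h3 : (s ^ 2)⁻¹ * ((t - θ) * (t - θ)) ≤ 1 := by
      rw [inv_mul_le_iff₀ (by positivity), mul_one]
      exact h2
    have h4 : 0 ≤ (s ^ 2)⁻¹ * ((t - θ) * (t - θ)) :=
      mul_nonneg (by positivity) (mul_self_nonneg _)
    rw [hqt]
    refine ⟨by linarith, by linarith, fun h => ?_⟩
    have : 0 < (s ^ 2)⁻¹ * ((t - θ) * (t - θ)) :=
      mul_pos (by positivity) (mul_self_pos.mpr (sub_ne_zero.mpr h))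
    linarith
  have hlim1 : Tendsto (fun k : ℕ => ∫ t, (q.eval t) ^ k ∂ν) atTop (𝓝 (ν.real {θ})) := by
    have h1 : ∫ t, ({θ} : Set ℝ).indicator (fun _ => (1 : ℝ)) t ∂ν = ν.real {θ} :=
      integral_indicator_one (measurableSet_singleton θ)
    rw [← h1]
    refine tendsto_integral_of_dominated_convergence (fun _ => 1) (fun k => ?_)
      (integrable_const 1) (fun k => ?_) ?_
    · exact (q.continuous.pow k).aestronglyMeasurable
    · filter_upwards [hae] with t ht
      obtain ⟨h2, h3, -⟩ := hbound t ht
      rw [Real.norm_of_nonneg (by positivity)]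
      exact pow_le_one₀ h2 h3
    · filter_upwards [hae] with t ht
      obtain ⟨h2, h3, h4⟩ := hbound t ht
      by_cases htθ : t = θ
      · have : q.eval t = 1 := by rw [hqt, htθ]; simp
        rw [Set.indicator_of_mem (by simpa using htθ)]
        simp only [this, one_pow]
        exact tendsto_const_nhds
      · rw [Set.indicator_of_notMem (by simpa using htθ)]
        exact tendsto_pow_atTop_nhds_zero_of_lt_one h2 (h4 htθ)
  -- Passing to Cesàro means makes von Neumann's mean ergodic theorem applicable to T, whose fixed
  -- space is the kernel of N, the θ-eigenspace of A.
  have hlim2 : Tendsto (fun n : ℕ => inner ℂ (birkhoffAverage ℂ T _root_.id n x) x) atTop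
      (𝓝 ((ν.real {θ} : ℝ) : ℂ)) := by
    have h1 := (Complex.continuous_ofReal.tendsto _).comp hlim1.cesaro
    refine h1.congr fun n => ?_
    simp only [Function.comp_apply, birkhoffAverage, birkhoffSum, _root_.id]
    rw [inner_smul_left, sum_inner]
    push_cast
    simp only [hmomq]
    simp
  have hker : T.eqLocus (1 : H →L[ℂ] H) = (N : H →ₗ[ℂ] H).ker := by
    ext v
    exact sub_inv_sq_smul_apply_eq_iff hN hs0 v
  have hproj : ∀ (K K' : Submodule ℂ H) [K.HasOrthogonalProjection] [K'.HasOrthogonalProjection],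
      K = K' → K.starProjection = K'.starProjection := by
    intro K K' _ _ h
    subst h
    rfl
  have hlim3 : Tendsto (fun n : ℕ => inner ℂ (birkhoffAverage ℂ T _root_.id n x) x) atTop
      (𝓝 ((‖eigenProj A θ x‖ ^ 2 : ℝ) : ℂ)) := by
    have h1 := T.tendsto_birkhoffAverage_orthogonalProjection (norm_sub_inv_sq_smul_le hN hs0 hNs) x
    rw [← Submodule.starProjection_apply, hproj _ _ hker] at h1
    have h2 : Tendsto (fun n : ℕ => inner ℂ (birkhoffAverage ℂ T _root_.id n x) x) atTop
        (𝓝 (inner ℂ (eigenProj A θ x) x)) := h1.inner tendsto_const_nhds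
    rwa [← inner_conj_symm, inner_eigenProj, Complex.conj_ofReal] at h2
  have h := tendsto_nhds_unique hlim2 hlim3
  have h' : ν.real {θ} = ‖eigenProj A θ x‖ ^ 2 := by exact_mod_cast h
  rw [← h', ofReal_measureReal]

end SpectralAtom

/-! ### From rooted paths to lists -/

section Transfer

variable {V : Type*} {G : SimpleGraph V} {D : ℕ} {o : V}

/-- The vertices of a rooted path, from its end to its root. -/
def pathList (P : RootedPath G o) : List V := (P.2 : G.Walk o P.1).support.reverse

theorem pathList_eq_cons (P : RootedPath G o) :
    ∃ l, pathList P = P.1 :: l := by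
  obtain ⟨v, p, hp⟩ := P
  have h : (p.reverse).support = v :: p.reverse.support.tail := (SimpleGraph.Walk.cons_tail_support _).symm
  rw [SimpleGraph.Walk.support_reverse] at h
  exact ⟨_, h⟩

theorem pathList_ne_nil (P : RootedPath G o) : pathList P ≠ [] := by
  obtain ⟨l, h⟩ := pathList_eq_cons P
  simp [h]

theorem isPathIn_pathList (P : RootedPath G o) : IsPathIn G Set.univ (pathList P) := by
  obtain ⟨v, p, hp⟩ := P
  refine ⟨?_, List.nodup_reverse.mpr hp.support_nodup, fun _ _ => Set.mem_univ _⟩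
  rw [pathList, ← SimpleGraph.Walk.support_reverse]
  exact p.reverse.isChain_adj_support

theorem pathList_injective : Function.Injective (pathList : RootedPath G o → List V) := by
  intro P Q h
  obtain ⟨l, hP⟩ := pathList_eq_cons P
  obtain ⟨l', hQ⟩ := pathList_eq_cons Q
  have h1 : P.1 = Q.1 := by
    rw [hP, hQ] at h
    exact (List.cons_eq_cons.mp h).1
  obtain ⟨v, p, hp⟩ := P
  obtain ⟨w, q, hq⟩ := Q
  obtain rfl : v = w := h1
  have h2 : p.support = q.support := List.reverse_injective h
  have h3 : p = q := SimpleGraph.Walk.ext_support h2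
  subst h3
  rfl

theorem pathList_of_isExtension {P Q : RootedPath G o} (h : IsExtension P Q) :
    pathList Q = Q.1 :: pathList P := by
  obtain ⟨h1, h2⟩ := h
  rw [pathList, h2, SimpleGraph.Walk.support_concat, List.reverse_append]
  rfl

theorem exists_isExtension {P : RootedPath G o} {x : V} (hx : G.Adj P.1 x)
    (hxP : x ∉ pathList P) : ∃ Q, IsExtension P Q ∧ pathList Q = x :: pathList P := by
  have h : ((P.2 : G.Walk o P.1).concat hx).IsPath :=
    (SimpleGraph.Walk.concat_isPath_iff hx).mpr ⟨P.2.2, fun h => hxP (List.mem_reverse.mpr h)⟩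
  have hQ : IsExtension P ⟨x, ⟨_, h⟩⟩ := ⟨hx, rfl⟩
  exact ⟨_, hQ, pathList_of_isExtension hQ⟩

theorem walk_eq_nil_or_concat {u v : V} (p : G.Walk u v) :
    p.support = [u] ∨ ∃ (w : V) (q : G.Walk u w) (h : G.Adj w v), p = q.concat h := by
  induction p using SimpleGraph.Walk.concatRec with
  | Hnil => exact Or.inl rfl
  | Hconcat q h _ => exact Or.inr ⟨_, q, h, rfl⟩

theorem exists_isExtension_of_pathList_eq_cons {P : RootedPath G o} {a : V} {l : List V}
    (h : pathList P = a :: l) (hl : l ≠ []) : ∃ Q, IsExtension Q P ∧ pathList Q = l := by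
  obtain ⟨v, p, hp⟩ := P
  rcases walk_eq_nil_or_concat p with h1 | ⟨w, q, hwv, rfl⟩
  · rw [pathList, h1] at h
    exact (hl (List.cons_eq_cons.mp h).2.symm).elim
  · have hQ : IsExtension (⟨w, ⟨q, ((SimpleGraph.Walk.concat_isPath_iff hwv).mp hp).1⟩⟩ :
        RootedPath G o) ⟨v, ⟨q.concat hwv, hp⟩⟩ := ⟨hwv, rfl⟩
    refine ⟨_, hQ, ?_⟩
    rw [pathList_of_isExtension hQ] at h
    exact (List.cons_eq_cons.mp h).2

/-- The image of `pathList` is closed under adjacency, so walks in the list graph that start in it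
never leave the copy of the path tree. -/
theorem listGraph_adj_pathList {P : RootedPath G o} {l : List V} :
    (listGraph G Set.univ).Adj (pathList P) l ↔ ∃ Q, (pathTree G o).Adj P Q ∧ pathList Q = l := by
  obtain ⟨l₀, hP⟩ := pathList_eq_cons P
  have hpath := isPathIn_pathList P
  constructor
  · intro h
    rw [hP, listGraph_adj_cons (hP ▸ hpath), ← hP] at h
    rcases h with ⟨h1, rfl⟩ | ⟨x, ⟨h1, -, h2⟩, rfl⟩
    · obtain ⟨Q, hQ, hl⟩ := exists_isExtension_of_pathList_eq_cons hP h1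
      exact ⟨Q, pathTree_adj.mpr (Or.inr hQ), hl⟩
    · obtain ⟨Q, hQ, hl⟩ := exists_isExtension h1 h2
      exact ⟨Q, pathTree_adj.mpr (Or.inl hQ), hl⟩
  · rintro ⟨Q, hQ, rfl⟩
    rw [listGraph_adj]
    rcases pathTree_adj.mp hQ with h | h
    · exact Or.inl ⟨pathList_ne_nil P, isPathIn_pathList Q, _, pathList_of_isExtension h⟩
    · exact Or.inr ⟨pathList_ne_nil Q, hpath, _, pathList_of_isExtension h⟩

theorem listOp_pow_chi_pathList (hG : BoundedDegree G D) (o : V) (n : ℕ) (P : RootedPath G o) :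
    ((listOp hG Set.univ ^ n) (chi [o]) : List V → ℂ) (pathList P) =
      ((adjOperator (pathTree_boundedDegree hG o) ^ n) (chi (trivialPath G o)) :
        RootedPath G o → ℂ) P := by
  classical
  induction n generalizing P with
  | zero =>
    simp only [pow_zero, one_apply_eq_self, chi_apply]
    have : pathList (trivialPath G o) = [o] := rfl
    rw [← this, pathList_injective.eq_iff]
  | succ n ih =>
    have hL := listGraph_boundedDegree hG Set.univ
    have hT := pathTree_boundedDegree hG o
    have hset : hL.nbrs (pathList P) = (hT.nbrs P).image pathList := by
      ext l
      rw [hL.mem_nbrs, listGraph_adj_pathList, Finset.mem_image]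
      simp only [hT.mem_nbrs]
    rw [pow_succ', pow_succ', mul_apply_eq_comp, mul_apply_eq_comp]
    nth_rewrite 1 [listOp]
    rw [adjOperator_apply, adjOperator_apply, hset, Finset.sum_image pathList_injective.injOn]
    exact Finset.sum_congr rfl fun Q _ => ih Q

theorem matchingMeasure_singleton (hG : BoundedDegree G D) (θ : ℝ) (o : V) :
    matchingMeasure hG o {θ} = ENNReal.ofReal (atom hG θ Set.univ o) := by
  obtain ⟨h1, h2, h3⟩ := matchingMeasure_spec hG o
  -- The measure enters only through its support and its moments. Hence the operator on lists may
  -- replace that of the path tree as soon as the moments at the root agree, without a unitary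
  -- equivalence.
  refine measure_singleton_eq (listOp_isSelfAdjoint hG _) (norm_adjOperator_le _) h2 ?_ θ
  intro n
  rw [h3 n, ← inner_conj_symm, inner_chi_left, ← inner_conj_symm (𝕜 := ℂ) _ (chi [o]),
    inner_chi_left, ← listOp_pow_chi_pathList]
  rfl

end Transfer

end MatchingMeasure

end

theorem lemma1p4 {V : Type*} (G : SimpleGraph V) (hconn : G.Connected)
    (D : ℕ) (hD : MatchingMeasure.BoundedDegree G D) (θ : ℝ)
    (hcrit : MatchingMeasure.IsCritical hD θ) :
    ∑' o : V, MatchingMeasure.matchingMeasure hD o {θ} = 1 := by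
  simp only [MatchingMeasure.matchingMeasure_singleton]
  refine MatchingMeasure.tsum_atom hconn fun u h => ?_
  have h1 : 0 < MatchingMeasure.matchingMeasure hD u {θ} := hcrit u
  rw [MatchingMeasure.matchingMeasure_singleton, h, ENNReal.ofReal_zero] at h1
  exact lt_irrefl _ h1
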